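/- Let $\mathcal B_C$ be the space of continuous $F:\mathbb R\to\mathbb R$ with $\lim_{x\to-\infty}F(x)=0$ and a real limit $F(\infty)$ at $+\infty$. Let $\mathcal A_C$ be the space of distributions $f=F'$ with $F\in\mathcal B_C$ (the primitive $F$ is unique); put $\int_a^b f=F(b)-F(a)$ for $-\infty\le a\le b\le\infty$, and give $\mathcal A_C$ the Alexiewicz norm $\|f\|=\sup_I|\int_I f|$, the supremum being over all intervals $I\subset\mathbb R$. For $f\in\mathcal A_C$ with primitive $F$ and $g:\mathbb R\to\mathbb R$ of bounded variation ($g\in\mathcal{BV}$) put $\int fg=F(\infty)g(\infty)-\int F\,dg$ (Stieltjes integral) and $f\ast g(x)=\int f(x-\cdot)\,g$. Functions are identified with the distributions they define, $\tau_z$ is translation ($\tau_zg(x)=g(x-z)$), and $\operatorname{supp}$ is the support of a distribution. Let $f\in\mathcal A_C$ and $g\in L^1(\mathbb R)$ (real-valued). There is a unique $f\ast g\in\mathcal A_C$ such that, for every sequence $(g_n)$ in $\mathcal{BV}\cap L^1$ with $\|g_n-g\|_1\to0$, one has $f\ast g_n\in\mathcal A_C$ for all $n$ and $\|f\ast g_n-f\ast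 g\|\to0$. Moreover: (a) $\|f\ast g\|\le\|f\|\,\|g\|_1$. (b) If $h\in L^1$ then $g\ast h\in L^1$ and $(f\ast g)\ast h=f\ast(g\ast h)\in\mathcal A_C$. (c) For each $z\in\mathbb R$, $\tau_z(f\ast g)=(\tau_zf)\ast g=f\ast(\tau_zg)$. (d) For each $f\in\mathcal A_C$ the map $\Phi_f:L^1\to\mathcal A_C$, $\Phi_f[g]=f\ast g$, is a bounded linear operator with $\|\Phi_f\|\le\|f\|$, and there is a nonzero $f\in\mathcal A_C$ with $\|\Phi_f\|=\|f\|$. For each $g\in L^1$ the map $\Psi_g:\mathcal A_C\to\mathcal A_C$, $\Psi_g[f]=f\ast g$, is a bounded linear operator with $\|\Psi_g\|\le\|g\|_1$, and there is a nonzero $g\in L^1$ with $\|\Psi_g\|=\|g\|_1$. (e) Let $g_t(x)=g(x/t)/t$ for $t>0$. Then $\int_{-\infty}^\infty g_t=\int_{-\infty}^\infty g=:a$ for all $t>0$, and $\|f\ast g_t-af\|\to0$ as $t\to0^+$. (f) $\operatorname{supp}(f\ast g)\subset\overline{\operatorname{supp}f+\operatorname{supp}g}$; in particular $\operatorname{supp}(f\ast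 g)\subset\operatorname{supp}f+\operatorname{supp}g$ whenever the set $\operatorname{supp}f+\operatorname{supp}g$ is closed. -/

import Mathlib

open Set Filter Topology MeasureTheory
open scoped Distributions ContDiff

noncomputable section

namespace CPI

/-- Real test functions on the line, with the usual LF topology. -/
abbrev Test : Type := 𝓓((⊤ : TopologicalSpace.Opens ℝ), ℝ)

/-- Schwartz distributions on the line: continuous linear functionals on test functions. -/
abbrev Dist : Type := 𝓓'((⊤ : TopologicalSpace.Opens ℝ), ℝ)

/-- The distribution `φ ↦ ∫ u φ` of a locally integrable function `u`. -/
def ofFun (u : ℝ → ℝ) : Dist :=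
  (TestFunction.integralAgainstBilinCLM (ContinuousLinearMap.mul ℝ ℝ) volume u : Test →L[ℝ] ℝ)

/-- The distributional derivative, `⟨T', φ⟩ = -⟨T, φ'⟩`. -/
def distDeriv : Dist →L[ℝ] Dist := Distribution.lineDerivCLM (1 : ℝ)

lemma ofFun_apply {u : ℝ → ℝ} (hu : Continuous u) (φ : Test) :
    ofFun u φ = ∫ x, φ x * u x := by
  have h : LocallyIntegrableOn u ((⊤ : TopologicalSpace.Opens ℝ) : Set ℝ) volume :=
    hu.locallyIntegrable.locallyIntegrableOn _
  exact TestFunction.integralAgainstBilinCLM_eq_integral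
    (B := ContinuousLinearMap.mul ℝ ℝ) h (f := φ)

lemma distDeriv_apply (T : Dist) (φ ψ : Test) (h : ∀ x, ψ x = deriv φ x) :
    distDeriv T φ = - T ψ := by
  have : (TestFunction.lineDerivCLM ℝ (1 : ℝ) φ : Test) = ψ := by
    ext x
    rw [TestFunction.lineDerivCLM_apply_of_le (by simp), h,
      (φ.contDiff.differentiable (by simp)).differentiableAt.lineDeriv_eq_fderiv]
    simp
  rw [← this]
  rfl

/-- The space of primitives: continuous functions on the line with limit `0` at `-∞` and a real
limit at `+∞`. -/
def BC : Submodule ℝ (ℝ → ℝ) where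
  carrier := {F | Continuous F ∧ Tendsto F atBot (𝓝 0) ∧ ∃ L : ℝ, Tendsto F atTop (𝓝 L)}
  zero_mem' := ⟨continuous_const, tendsto_const_nhds, 0, tendsto_const_nhds⟩
  add_mem' := by
    rintro F G ⟨hF, hF0, L, hL⟩ ⟨hG, hG0, M, hM⟩
    exact ⟨hF.add hG, by rw [← add_zero (0 : ℝ)]; exact hF0.add hG0, L + M, hL.add hM⟩
  smul_mem' := by
    rintro c F ⟨hF, hF0, L, hL⟩
    exact ⟨hF.const_smul c, by rw [← smul_zero c]; exact hF0.const_smul c, c • L, hL.const_smul c⟩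

/-- `F ↦ F'` (distributional derivative) on the space of primitives. -/
def derivBC : BC →ₗ[ℝ] Dist where
  toFun F := distDeriv (ofFun F.1)
  map_add' F G := by
    rw [← map_add]
    congr 1
    ext φ
    have hF := F.2.1
    have hG := G.2.1
    change ofFun (F.1 + G.1) φ = ofFun F.1 φ + ofFun G.1 φ
    rw [ofFun_apply hF, ofFun_apply hG, ofFun_apply (hF.add hG), ← integral_add]
    · simp [mul_add]
    · exact (φ.continuous.mul hF).integrable_of_hasCompactSupport φ.hasCompactSupport.mul_right
    · exact (φ.continuous.mul hG).integrable_of_hasCompactSupport φ.hasCompactSupport.mul_right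
  map_smul' c F := by
    rw [← map_smul]
    congr 1
    ext φ
    have hF := F.2.1
    change ofFun (c • F.1) φ = c • ofFun F.1 φ
    rw [ofFun_apply hF, ofFun_apply (hF.const_smul c), ← integral_smul]
    congr 1
    ext x
    simp only [Pi.smul_apply, smul_eq_mul]
    ring

/-- If `φ` is a test function, so is `x ↦ ∫ y in x..x - h, φ y`, with derivative
`φ (x - h) - φ x`. -/
lemma exists_test (φ : Test) (h : ℝ) :
    ∃ ψ : Test, ∀ x, HasDerivAt ψ (φ (x - h) - φ x) x := by
  set P : ℝ → ℝ := fun x => ∫ y in (0 : ℝ)..x, φ y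
  have hint : ∀ a b : ℝ, IntervalIntegrable φ volume a b :=
    fun a b => φ.continuous.intervalIntegrable a b
  have hP : ∀ x, HasDerivAt P (φ x) x := fun x =>
    intervalIntegral.integral_hasDerivAt_right (hint 0 x)
      φ.continuous.aestronglyMeasurable.stronglyMeasurableAtFilter φ.continuous.continuousAt
  have hPs : ContDiff ℝ ∞ P := by
    rw [contDiff_infty_iff_deriv]
    refine ⟨fun x => (hP x).differentiableAt, ?_⟩
    rw [show deriv P = φ from funext fun x => (hP x).deriv]
    exact φ.contDiff
  obtain ⟨R, hR⟩ := φ.hasCompactSupport.isCompact.isBounded.subset_closedBall (0 : ℝ)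
  refine ⟨⟨fun x => P (x - h) - P x, ?_, ?_, by simp⟩, fun x => ?_⟩
  · exact (hPs.comp (contDiff_id.sub contDiff_const)).sub hPs
  · refine HasCompactSupport.of_support_subset_isCompact
      (isCompact_closedBall (0 : ℝ) (R + |h|)) fun x hx => ?_
    by_contra hxR
    apply hx
    have h1 : P (x - h) - P x = ∫ y in x..(x - h), φ y := by
      simp only [P]
      rw [intervalIntegral.integral_interval_sub_left (hint _ _) (hint _ _)]
    change P (x - h) - P x = 0
    rw [h1]
    refine intervalIntegral.integral_zero_ae (ae_of_all _ fun y hy => ?_)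
    by_contra hy0
    have h2 : |y| ≤ R := by
      have := hR (subset_tsupport _ hy0)
      simpa using this
    have h3 : R + |h| < |x| := by simpa using hxR
    have h4 : |y - x| ≤ |h| := by
      have := abs_sub_left_of_mem_uIcc (uIoc_subset_uIcc hy)
      simpa using this
    have h5 : |x| ≤ |y| + |y - x| := by
      calc |x| = |y - (y - x)| := by ring_nf
        _ ≤ _ := abs_sub _ _
    linarith
  · have := (hP (x - h)).comp_sub_const x h
    exact this.sub (hP x)

/-- A primitive is determined by its distributional derivative. -/
lemma derivBC_injective : Function.Injective derivBC := by
  rw [← LinearMap.ker_eq_bot, LinearMap.ker_eq_bot']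
  intro F hF
  have hc : Continuous F.1 := F.2.1
  have key : ∀ h x : ℝ, F.1 (x + h) - F.1 x = 0 := by
    intro h
    have hG : Continuous fun x => F.1 (x + h) - F.1 x :=
      (hc.comp (continuous_id.add continuous_const)).sub hc
    have hae : ∀ᵐ x ∂(volume : Measure ℝ), F.1 (x + h) - F.1 x = 0 := by
      refine ae_eq_zero_of_integral_contDiff_smul_eq_zero hG.locallyIntegrable
        fun g hg hgc => ?_
      let φ : Test := ⟨g, hg, hgc, by simp⟩
      obtain ⟨ψ, hψ⟩ := exists_test φ h
      let φh : Test := ⟨fun x => g (x - h) - g x,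
        (hg.comp (contDiff_id.sub contDiff_const)).sub hg,
        (hgc.comp_homeomorph (Homeomorph.subRight h)).sub hgc, by simp⟩
      have h0 : derivBC F ψ = 0 := by rw [hF]; rfl
      have h1 : derivBC F ψ = - ofFun F.1 φh :=
        distDeriv_apply _ _ _ fun x => (hψ x).deriv.symm
      rw [h0, ofFun_apply hc] at h1
      have i1 : Integrable fun x => g x * F.1 x :=
        (hg.continuous.mul hc).integrable_of_hasCompactSupport hgc.mul_right
      have i2 : Integrable fun x => g x * F.1 (x + h) :=
        (hg.continuous.mul (hc.comp (continuous_id.add continuous_const))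
          ).integrable_of_hasCompactSupport hgc.mul_right
      have i3 : Integrable fun x => g (x - h) * F.1 x := by
        have := i2.comp_sub_right h
        simpa using this
      have e3 : ∫ x, g (x - h) * F.1 x = ∫ x, g x * F.1 (x + h) := by
        rw [← integral_sub_right_eq_self (fun x => g x * F.1 (x + h)) h]
        simp
      have h2 : ∫ x, φh x * F.1 x = (∫ x, g (x - h) * F.1 x) - ∫ x, g x * F.1 x := by
        rw [← integral_sub i3 i1]
        congr 1
        ext x
        change (g (x - h) - g x) * F.1 x = _
        ring
      simp only [smul_eq_mul, mul_sub]
      rw [integral_sub i2 i1, ← e3, ← h2]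
      linarith
    have := (Continuous.ae_eq_iff_eq volume hG continuous_const).1 hae
    exact fun x => congrFun this x
  have hconst : ∀ x, F.1 x = F.1 0 := fun x => by
    have := key x 0
    rw [zero_add] at this
    linarith
  have h0 : F.1 0 = 0 := by
    have h1 : Tendsto F.1 atBot (𝓝 (F.1 0)) := by
      rw [show F.1 = fun _ => F.1 0 from funext hconst]
      exact tendsto_const_nhds
    exact tendsto_nhds_unique h1 F.2.2.1
  ext x
  change F.1 x = 0
  rw [hconst, h0]

/-- The space `A_C` of integrable distributions: the distributions `F'` with `F` in `BC`. -/
def AC : Type := LinearMap.range derivBC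

instance : AddCommGroup AC := inferInstanceAs (AddCommGroup (LinearMap.range derivBC))

instance : Module ℝ AC := inferInstanceAs (Module ℝ (LinearMap.range derivBC))

/-- The inclusion of `A_C` in the distributions. -/
def AC.toDist : AC →ₗ[ℝ] Dist := (LinearMap.range derivBC).subtype

/-- The unique `F` in `BC` with `F' = f`. -/
def AC.primitive : AC ≃ₗ[ℝ] BC := (LinearEquiv.ofInjective derivBC derivBC_injective).symm

lemma AC.toDist_injective : Function.Injective AC.toDist := Subtype.val_injective

lemma AC.deriv_primitive (f : AC) : distDeriv (ofFun (AC.primitive f).1) = AC.toDist f :=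
  congrArg Subtype.val
    ((LinearEquiv.ofInjective derivBC derivBC_injective).apply_symm_apply f)

lemma AC.primitive_eq (f : AC) (F : BC) (h : distDeriv (ofFun F.1) = AC.toDist f) :
    AC.primitive f = F :=
  derivBC_injective ((AC.deriv_primitive f).trans h.symm)

/-- The value at a point of the extended line of a function with limits at `±∞`. -/
def extend (u : ℝ → ℝ) (a : EReal) : ℝ :=
  if a = ⊥ then limUnder atBot u else if a = ⊤ then limUnder atTop u else u a.toReal

/-- The continuous primitive integral `∫_a^b f = F(b) - F(a)`, for `-∞ ≤ a, b ≤ ∞`. -/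
def AC.integral (f : AC) (a b : EReal) : ℝ :=
  extend (AC.primitive f).1 b - extend (AC.primitive f).1 a

/-- The Alexiewicz norm: the supremum of `|∫_I f|` over all intervals `I` (bounded or not). -/
instance : Norm AC where
  norm f := ⨆ p : {p : EReal × EReal // p.1 ≤ p.2}, |f.integral p.1.1 p.1.2|

lemma extend_add (F G : BC) (a : EReal) :
    extend (F + G).1 a = extend F.1 a + extend G.1 a := by
  obtain ⟨-, hF0, L, hL⟩ := F.2
  obtain ⟨-, hG0, M, hM⟩ := G.2
  unfold extend
  split_ifs
  · rw [hF0.limUnder_eq, hG0.limUnder_eq]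
    exact (hF0.add hG0).limUnder_eq
  · rw [hL.limUnder_eq, hM.limUnder_eq]
    exact (hL.add hM).limUnder_eq
  · rfl

lemma extend_smul (c : ℝ) (F : BC) (a : EReal) :
    extend (c • F).1 a = c * extend F.1 a := by
  obtain ⟨-, hF0, L, hL⟩ := F.2
  unfold extend
  split_ifs
  · rw [hF0.limUnder_eq]
    exact (hF0.const_smul c).limUnder_eq
  · rw [hL.limUnder_eq]
    exact (hL.const_smul c).limUnder_eq
  · rfl

lemma exists_bound (F : BC) : ∃ C, ∀ a, |extend F.1 a| ≤ C := by
  obtain ⟨hF, hF0, L, hL⟩ := F.2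
  obtain ⟨A, hA⟩ := (hF0.eventually (Metric.ball_mem_nhds 0 one_pos)).exists_forall_of_atBot
  obtain ⟨B, hB⟩ := (hL.eventually (Metric.ball_mem_nhds L one_pos)).exists_forall_of_atTop
  obtain ⟨D, hD⟩ := (isCompact_Icc (a := A) (b := B)).exists_bound_of_continuousOn hF.continuousOn
  have hr : ∀ x : ℝ, |F.1 x| ≤ |D| + |L| + 1 := by
    intro x
    have hL0 := abs_nonneg L
    have hD0 := abs_nonneg D
    rcases le_total x A with h | h
    · have := hA x h
      rw [Real.dist_eq, sub_zero] at this
      linarith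
    · rcases le_total x B with h' | h'
      · have := hD x ⟨h, h'⟩
        rw [Real.norm_eq_abs] at this
        have := le_abs_self D
        linarith
      · have := hB x h'
        rw [Real.dist_eq] at this
        have h3 := abs_sub_abs_le_abs_sub (F.1 x) L
        linarith
  refine ⟨|D| + |L| + 1, fun a => ?_⟩
  unfold extend
  split_ifs
  · rw [hF0.limUnder_eq, abs_zero]
    positivity
  · rw [hL.limUnder_eq]
    have hD0 := abs_nonneg D
    linarith
  · exact hr _

lemma AC.bddAbove (f : AC) :
    BddAbove (range fun p : {p : EReal × EReal // p.1 ≤ p.2} => |f.integral p.1.1 p.1.2|) := by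
  obtain ⟨C, hC⟩ := exists_bound (AC.primitive f)
  refine ⟨C + C, ?_⟩
  rintro _ ⟨p, rfl⟩
  exact (abs_sub _ _).trans (add_le_add (hC _) (hC _))

instance : Nonempty {p : EReal × EReal // p.1 ≤ p.2} := ⟨⟨(⊥, ⊥), le_rfl⟩⟩

lemma AC.abs_integral_le (f : AC) {a b : EReal} (h : a ≤ b) : |f.integral a b| ≤ ‖f‖ :=
  le_ciSup f.bddAbove ⟨(a, b), h⟩

lemma AC.core : NormedSpace.Core ℝ AC where
  norm_nonneg f := (abs_nonneg _).trans (f.abs_integral_le (le_refl ⊥))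
  norm_smul c f := by
    have : ∀ a b, |(c • f).integral a b| = |c| * |f.integral a b| := fun a b => by
      rw [← abs_mul]
      simp only [AC.integral, map_smul, extend_smul, mul_sub]
    change (⨆ p : {p : EReal × EReal // p.1 ≤ p.2}, |(c • f).integral p.1.1 p.1.2|) = _
    simp only [this]
    rw [← Real.mul_iSup_of_nonneg (abs_nonneg c)]
    rfl
  norm_triangle f g := by
    refine ciSup_le fun p => ?_
    have : (f + g).integral p.1.1 p.1.2 = f.integral p.1.1 p.1.2 + g.integral p.1.1 p.1.2 := by
      simp only [AC.integral, map_add, extend_add]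
      ring
    rw [this]
    exact (abs_add_le _ _).trans (add_le_add (f.abs_integral_le p.2) (g.abs_integral_le p.2))
  norm_eq_zero_iff f := by
    constructor
    · intro h
      apply AC.primitive.injective
      rw [map_zero]
      ext x
      have h1 := f.abs_integral_le (bot_le (a := (x : EReal)))
      rw [h] at h1
      have h2 : f.integral ⊥ x = 0 := abs_eq_zero.1 (le_antisymm h1 (abs_nonneg _))
      simpa [AC.integral, extend, (AC.primitive f).2.2.1.limUnder_eq] using h2
    · rintro rfl
      have : ∀ a b, (0 : AC).integral a b = 0 := fun a b => by
        have h0 : ∀ c, extend (0 : BC).1 c = 0 := fun c => by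
          simpa using extend_smul 0 (0 : BC) c
        simp only [AC.integral, map_zero, h0, sub_zero]
      change (⨆ p : {p : EReal × EReal // p.1 ≤ p.2}, |(0 : AC).integral p.1.1 p.1.2|) = 0
      simp [this]

instance : NormedAddCommGroup AC := NormedAddCommGroup.ofCore AC.core

instance : NormedSpace ℝ AC := NormedSpace.ofCore AC.core

/-- Composition of test functions with the isometry `y ↦ e y + c` of the line. -/
def testComp (e : ℝ ≃ₗᵢ[ℝ] ℝ) (c : ℝ) : Test →L[ℝ] Test :=
  let σ : ℝ ≃ₜ ℝ := e.toHomeomorph.trans (Homeomorph.addRight c)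
  TestFunction.limitCLM ℝ
    (fun φ => ⟨fun y => φ (e y + c), φ.contDiff.comp (e.contDiff.add contDiff_const),
      φ.hasCompactSupport.comp_homeomorph σ, by simp⟩)
    (fun K _ =>
      TestFunction.ofSupportedInCLM ℝ (K := K.map σ.symm σ.symm.continuous) (by simp) ∘L
      ContDiffMapSupportedIn.mkCLM ℝ (fun φ y => φ (e y + c))
        (fun _ _ _ => rfl) (fun _ _ _ => rfl)
        (fun φ => φ.contDiff.comp (e.contDiff.add contDiff_const))
        (fun φ y hy => φ.zero_on_compl fun h => hy ⟨σ y, h, σ.symm_apply_apply y⟩)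
        (fun i hi => ⟨{i}, 1, zero_le_one, fun φ y _ => by
          have h1 := e.norm_iteratedFDeriv_comp_right (𝕜 := ℝ) (fun y => φ (y + c)) y i
          rw [iteratedFDeriv_comp_add_right] at h1
          have h2 : ((fun y => φ (y + c)) ∘ e) = fun y => φ (e y + c) := rfl
          rw [h2] at h1
          rw [h1, one_mul, Finset.sup_singleton]
          exact ContDiffMapSupportedIn.norm_iteratedFDeriv_apply_le_seminorm ℝ hi⟩))
    (fun _ _ _ => rfl)

/-- The translation `τ_z φ (y) = φ (y - z)` of test functions. -/
def testTranslate (z : ℝ) : Test →L[ℝ] Test := testComp (LinearIsometryEquiv.refl ℝ ℝ) (-z)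

/-- Composition of test functions with the reflection `r_x y = x - y`. -/
def testReflect (x : ℝ) : Test →L[ℝ] Test := testComp (LinearIsometryEquiv.neg ℝ) x

lemma testTranslate_apply (z : ℝ) (φ : Test) (y : ℝ) : testTranslate z φ y = φ (y - z) := rfl

lemma testReflect_apply (x : ℝ) (φ : Test) (y : ℝ) : testReflect x φ y = φ (x - y) := by
  change φ (-y + x) = φ (x - y)
  congr 1
  ring

/-- The translation of a distribution, `⟨τ_z T, φ⟩ = ⟨T, τ_{-z} φ⟩`. -/
def distTranslate (z : ℝ) : Dist →L[ℝ] Dist :=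
  (testTranslate (-z)).precompCompactConvergenceCLM ℝ

/-- The composition `T ∘ r_x` of a distribution with the reflection `r_x y = x - y`. As `r_x` is
an involution with `|r_x'| = 1`, this is `⟨T ∘ r_x, φ⟩ = ⟨T, φ ∘ r_x⟩`. -/
def distReflect (x : ℝ) : Dist →L[ℝ] Dist :=
  (testReflect x).precompCompactConvergenceCLM ℝ

lemma distTranslate_apply (z : ℝ) (T : Dist) (φ : Test) :
    distTranslate z T φ = T (testTranslate (-z) φ) := rfl

lemma distReflect_apply (x : ℝ) (T : Dist) (φ : Test) :
    distReflect x T φ = T (testReflect x φ) := rfl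

/-- The derivative of a test function as a test function. -/
lemma exists_deriv (φ : Test) : ∃ ψ : Test, ∀ x, ψ x = deriv φ x := by
  refine ⟨⟨deriv φ, ?_, φ.hasCompactSupport.deriv, by simp⟩, fun x => rfl⟩
  exact (contDiff_infty_iff_deriv.1 φ.contDiff).2

lemma distTranslate_deriv (z : ℝ) (F : BC) :
    ∃ G : BC, derivBC G = distTranslate z (derivBC F) := by
  obtain ⟨hF, hF0, L, hL⟩ := F.2
  have hG : Continuous fun y => F.1 (y - z) := hF.comp (continuous_id.sub continuous_const)
  refine ⟨⟨fun y => F.1 (y - z), hG, hF0.comp (tendsto_atBot_add_const_right _ (-z) tendsto_id),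
    L, hL.comp (tendsto_atTop_add_const_right _ (-z) tendsto_id)⟩, ?_⟩
  ext φ
  obtain ⟨ψ, hψ⟩ := exists_deriv φ
  rw [distTranslate_apply]
  change distDeriv (ofFun fun y => F.1 (y - z)) φ = distDeriv (ofFun F.1) _
  rw [distDeriv_apply _ φ ψ hψ, distDeriv_apply _ _ (testTranslate (-z) ψ), ofFun_apply hG,
    ofFun_apply hF,
    ← integral_sub_right_eq_self (fun y => testTranslate (-z) ψ y * F.1 y) z]
  · simp [testTranslate_apply]
  · intro y
    rw [testTranslate_apply, hψ]
    exact (deriv_comp_sub_const (f := φ) (-z) y).symm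

lemma distReflect_deriv (x : ℝ) (F : BC) :
    ∃ G : BC, derivBC G = distReflect x (derivBC F) := by
  obtain ⟨hF, hF0, L, hL⟩ := F.2
  have hG : Continuous fun y => L - F.1 (x - y) :=
    continuous_const.sub (hF.comp (continuous_const.sub continuous_id))
  refine ⟨⟨fun y => L - F.1 (x - y), hG, ?_, L, ?_⟩, ?_⟩
  · rw [← sub_self L]
    exact tendsto_const_nhds.sub (hL.comp (tendsto_atTop_add_const_left _ x tendsto_neg_atBot_atTop))
  · simpa using! tendsto_const_nhds.sub (hF0.comp (tendsto_atBot_add_const_left _ x tendsto_neg_atTop_atBot))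
  ext φ
  obtain ⟨ψ, hψ⟩ := exists_deriv φ
  rw [distReflect_apply]
  change distDeriv (ofFun fun y => L - F.1 (x - y)) φ = distDeriv (ofFun F.1) _
  rw [distDeriv_apply _ φ ψ hψ, distDeriv_apply _ _ (-testReflect x ψ), ofFun_apply hG,
    ofFun_apply hF]
  · have i1 : Integrable fun y => ψ y * L :=
      (ψ.continuous.mul continuous_const).integrable_of_hasCompactSupport
        ψ.hasCompactSupport.mul_right
    have i2 : Integrable fun y => ψ y * F.1 (x - y) :=
      (ψ.continuous.mul (hF.comp (continuous_const.sub continuous_id))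
        ).integrable_of_hasCompactSupport ψ.hasCompactSupport.mul_right
    have h0 : ∫ y, ψ y = 0 := by
      have : (ψ : ℝ → ℝ) = deriv φ := funext hψ
      rw [this]
      refine integral_eq_zero_of_hasDerivAt_of_integrable (f := φ)
        (fun y => ((φ.contDiff.differentiable (by simp)) y).hasDerivAt) ?_ ?_
      · rw [← this]
        exact ψ.continuous.integrable_of_hasCompactSupport ψ.hasCompactSupport
      · exact φ.continuous.integrable_of_hasCompactSupport φ.hasCompactSupport
    have h1 : ∫ y, (-testReflect x ψ) y * F.1 y = - ∫ y, ψ y * F.1 (x - y) := by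
      rw [← integral_neg, ← integral_sub_left_eq_self _ volume x]
      congr 1
      ext y
      change -(testReflect x ψ) (x - y) * F.1 (x - y) = _
      rw [testReflect_apply]
      ring_nf
    rw [h1]
    simp only [mul_sub]
    rw [integral_sub i1 i2, integral_mul_const, h0]
    ring
  · intro y
    change -(testReflect x ψ) y = _
    have : (testReflect x φ : ℝ → ℝ) = fun y => φ (x - y) := funext (testReflect_apply x φ)
    rw [testReflect_apply, hψ, this, deriv_comp_const_sub]

/-- The translation `τ_z` on `A_C`. -/
def AC.translate (z : ℝ) (f : AC) : AC :=
  ⟨distTranslate z (AC.toDist f), by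
    obtain ⟨F, hF⟩ := f.2
    obtain ⟨G, hG⟩ := distTranslate_deriv z F
    exact ⟨G, by rw [hG, hF]; rfl⟩⟩

/-- The composition `f ∘ r_x`, that is, `y ↦ f (x - y)`, on `A_C`. -/
def AC.reflect (x : ℝ) (f : AC) : AC :=
  ⟨distReflect x (AC.toDist f), by
    obtain ⟨F, hF⟩ := f.2
    obtain ⟨G, hG⟩ := distReflect_deriv x F
    exact ⟨G, by rw [hG, hF]; rfl⟩⟩

open Classical in
/-- The integral `∫ f g` over the line for `f` in `A_C` and `g` of bounded variation, given by
integration by parts: `F(∞) g(∞) - ∫ F dg`, where `F` is the primitive of `f`. As `F` is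
continuous with limits at `±∞`, the Stieltjes integral is the integral of `F` against the signed
measure of `g`. -/
def AC.integralMul (f : AC) (g : ℝ → ℝ) : ℝ :=
  if hg : BoundedVariationOn g univ then
    extend (AC.primitive f).1 ⊤ * extend g ⊤ - ∫ᵛ y, (AC.primitive f).1 y ∂•hg.vectorMeasure
  else 0

/-- The convolution `f ∗ g (x) = ∫ f (x - y) g (y) dy` for `f` in `A_C` and `g` of bounded
variation. -/
def AC.convBV (f : AC) (g : ℝ → ℝ) (x : ℝ) : ℝ := (f.reflect x).integralMul g

/-- `k` is the limit in the Alexiewicz norm of `f ∗ g_n`, for every sequence `g_n` of integrable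
functions of bounded variation that converges to `g` in `L¹`. In particular, each of the functions
`f ∗ g_n` is (as a distribution) in `A_C`. -/
def AC.IsConv (f : AC) (g : ℝ → ℝ) (k : AC) : Prop :=
  ∀ gs : ℕ → ℝ → ℝ, (∀ n, BoundedVariationOn (gs n) univ ∧ Integrable (gs n)) →
    Tendsto (fun n => ∫ x, |gs n x - g x|) atTop (𝓝 0) →
    ∃ ks : ℕ → AC, (∀ n, AC.toDist (ks n) = ofFun (f.convBV (gs n))) ∧
      Tendsto (fun n => ‖ks n - k‖) atTop (𝓝 0)

open Classical in
/-- The convolution `f ∗ g` for `f` in `A_C` and `g` in `L¹`. -/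
def AC.conv (f : AC) (g : ℝ → ℝ) : AC :=
  if h : ∃ k, f.IsConv g k then h.choose else 0

/-- The dilation `g_t (x) = g (x / t) / t`. -/
def dilate (g : ℝ → ℝ) (t x : ℝ) : ℝ := g (x / t) / t

end CPI

end

/-!
The whole theorem is read off from one formula: if `F` is the primitive of `f`, then the primitive
of `f ∗ g` is the classical convolution `F ∗ g (x) = ∫ F (x - y) g (y) dy` (`AC.primitive_conv`),
a bounded continuous function times an integrable one under the integral sign.

`AC.convL1 f g` is defined as the derivative of `F ∗ g`. Since the Alexiewicz norm is the largest
oscillation of the primitive (`AC.abs_sub_le_norm`, `AC.norm_le_of_forall`), the estimate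
`‖f ∗ g‖ ≤ ‖f‖ ‖g‖₁` is immediate, and it gives the continuity in `g` that the definition by
approximation asks for. What remains is that `AC.convL1` extends the convolution with integrable
functions of bounded variation, `f ∗ g (x) = ∫ F (x - y) dg(y)`. This is the identity
`(F ∗ g)' = F ∗ dg`, proved in `AC.intervalIntegral_convBV`: the integral of the right side over
`[a, b]` is a Stieltjes integral of `y ↦ ∫_{a - y}^{b - y} F`, and integration by parts
(`integral_deriv_mul_eq_neg`) turns it into `F ∗ g (b) - F ∗ g (a)`. The integration by parts is
Fubini's theorem for the two parts of the Jordan decomposition of `dg`. Uniqueness follows from the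
density of smooth compactly supported functions in `L¹`.

Associativity, translation invariance and bilinearity are then properties of Lebesgue integrals.
The norm estimate is sharp for the indicator function of `[0, 1]` in both roles, because
`F ∗ g (∞) = F(∞) ∫ g`. For the approximate identity, `F ∗ g_t - (∫ g) F` is
`∫ (F (x - t y) - F x) g (y) dy`, which tends to `0` uniformly in `x` by dominated convergence and
uniform continuity of `F`. For the supports, `⟨f ∗ g, φ⟩ = ∫ g (y) ⟨f, φ (· + y)⟩ dy`; if
`φ` is supported off the closure of the sum of the two supports, then for `y` in the support of `g`
the translate `φ (· + y)` misses the support of `f`, and elsewhere `g` vanishes almost everywhere.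
-/

noncomputable section

namespace CPI

/-! ### The Alexiewicz norm in terms of the primitive -/

lemma extend_coe (u : ℝ → ℝ) (x : ℝ) : extend u x = u x := by
  simp [extend]

lemma extend_bot (F : BC) : extend F.1 ⊥ = 0 := by
  simp [extend, F.2.2.1.limUnder_eq]

lemma extend_top {u : ℝ → ℝ} {L : ℝ} (h : Tendsto u atTop (𝓝 L)) : extend u ⊤ = L := by
  simp [extend, h.limUnder_eq]

lemma BC.exists_abs_le (F : BC) : ∃ C, ∀ x, |F.1 x| ≤ C := by
  obtain ⟨C, hC⟩ := exists_bound F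
  exact ⟨C, fun x => by simpa [extend_coe] using hC x⟩

/-- Each value of the extension of a primitive to the extended line is a limit of values on the
line. -/
lemma BC.exists_tendsto_extend (F : BC) (a : EReal) :
    ∃ l : Filter ℝ, l.NeBot ∧ Tendsto F.1 l (𝓝 (extend F.1 a)) := by
  obtain ⟨-, h0, L, hL⟩ := F.2
  induction a with
  | bot => exact ⟨atBot, inferInstance, by rwa [extend_bot]⟩
  | top => exact ⟨atTop, inferInstance, by rwa [extend_top hL]⟩
  | coe x => exact ⟨pure x, inferInstance, by rw [extend_coe]; exact tendsto_pure_nhds _ _⟩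

lemma AC.abs_sub_le_norm (f : AC) (x y : ℝ) :
    |(AC.primitive f).1 y - (AC.primitive f).1 x| ≤ ‖f‖ := by
  wlog h : x ≤ y generalizing x y
  · rw [abs_sub_comm]
    exact this y x (le_of_not_ge h)
  · simpa [AC.integral, extend_coe] using f.abs_integral_le (EReal.coe_le_coe_iff.2 h)

lemma AC.abs_extend_top_le_norm (f : AC) : |extend (AC.primitive f).1 ⊤| ≤ ‖f‖ := by
  simpa [AC.integral, extend_bot] using f.abs_integral_le (bot_le (a := ⊤))

lemma AC.norm_le_of_forall (f : AC) {C : ℝ}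
    (h : ∀ x y, |(AC.primitive f).1 y - (AC.primitive f).1 x| ≤ C) : ‖f‖ ≤ C := by
  refine ciSup_le fun p => ?_
  obtain ⟨l, hl, hl'⟩ := BC.exists_tendsto_extend (AC.primitive f) p.1.1
  obtain ⟨m, hm, hm'⟩ := BC.exists_tendsto_extend (AC.primitive f) p.1.2
  have h1 : ∀ x, |extend (AC.primitive f).1 p.1.2 - (AC.primitive f).1 x| ≤ C := fun x =>
    le_of_tendsto (hm'.sub_const _).abs (Eventually.of_forall fun y => h x y)
  exact le_of_tendsto (hl'.const_sub _).abs (Eventually.of_forall h1)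

lemma AC.ext_primitive {f g : AC} (h : ∀ x, (AC.primitive f).1 x = (AC.primitive g).1 x) :
    f = g :=
  AC.primitive.injective (Subtype.ext (funext h))

/-! ### Convolution of a primitive with an integrable function -/

lemma BC.integrable_mul (F : BC) {g : ℝ → ℝ} {v : ℝ → ℝ} (hv : Continuous v) (hg : Integrable g) :
    Integrable fun y => F.1 (v y) * g y := by
  obtain ⟨C, hC⟩ := BC.exists_abs_le F
  exact hg.bdd_mul (F.2.1.comp hv).aestronglyMeasurable (ae_of_all _ fun y => hC _)

lemma BC.integrable_conv (F : BC) {g : ℝ → ℝ} (hg : Integrable g) (x : ℝ) :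
    Integrable fun y => F.1 (x - y) * g y :=
  BC.integrable_mul F (v := fun y => x - y) (continuous_const.sub continuous_id) hg

/-- Dominated convergence for `∫ F (v i y) g y` with `F` in `BC` and `g` integrable. -/
lemma BC.tendsto_integral_mul (F : BC) {g : ℝ → ℝ} (hg : Integrable g) {ι : Type*} {l : Filter ι}
    [l.IsCountablyGenerated] {v : ι → ℝ → ℝ} (hv : ∀ i, Continuous (v i)) {w : ℝ → ℝ}
    (h : ∀ y, Tendsto (fun i => F.1 (v i y)) l (𝓝 (w y))) :
    Tendsto (fun i => ∫ y, F.1 (v i y) * g y) l (𝓝 (∫ y, w y * g y)) := by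
  obtain ⟨C, hC⟩ := BC.exists_abs_le F
  refine tendsto_integral_filter_of_dominated_convergence (fun y => C * |g y|)
    (Eventually.of_forall fun i => (BC.integrable_mul F (hv i) hg).aestronglyMeasurable)
    (Eventually.of_forall fun i => ae_of_all _ fun y => ?_) (hg.abs.const_mul C)
    (ae_of_all _ fun y => (h y).mul_const _)
  rw [Real.norm_eq_abs, abs_mul]
  exact mul_le_mul_of_nonneg_right (hC _) (abs_nonneg _)

lemma BC.tendsto_conv_atTop (F : BC) {g : ℝ → ℝ} (hg : Integrable g) {L : ℝ}
    (hL : Tendsto F.1 atTop (𝓝 L)) :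
    Tendsto (fun x => ∫ y, F.1 (x - y) * g y) atTop (𝓝 (L * ∫ y, g y)) := by
  rw [← integral_const_mul]
  exact BC.tendsto_integral_mul F hg (v := fun x y => x - y) (w := fun _ => L)
    (fun x => continuous_const.sub continuous_id) fun y =>
    hL.comp (tendsto_atTop_add_const_right _ (-y) tendsto_id)

/-- The convolution `F ∗ g (x) = ∫ F (x - y) g (y) dy` of a primitive with an integrable
function, again a primitive, with limit `F(∞) ∫ g` at `+∞`. -/
def BC.conv (F : BC) (g : ℝ → ℝ) (hg : Integrable g) : BC :=
  ⟨fun x => ∫ y, F.1 (x - y) * g y, by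
    refine ⟨continuous_iff_continuousAt.2 fun x => ?_, ?_, ?_⟩
    · exact BC.tendsto_integral_mul F hg (fun x => continuous_const.sub continuous_id) fun y =>
        (F.2.1.comp (continuous_id.sub continuous_const)).tendsto x
    · have := BC.tendsto_integral_mul F hg (l := atBot) (v := fun x y => x - y) (w := fun _ => 0)
        (fun x => continuous_const.sub continuous_id) fun y =>
        F.2.2.1.comp (tendsto_atBot_add_const_right _ (-y) tendsto_id)
      simpa using this
    · obtain ⟨L, hL⟩ := F.2.2.2
      exact ⟨_, BC.tendsto_conv_atTop F hg hL⟩⟩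

lemma BC.conv_apply (F : BC) {g : ℝ → ℝ} (hg : Integrable g) (x : ℝ) :
    (BC.conv F g hg).1 x = ∫ y, F.1 (x - y) * g y := rfl

/-- The convolution of `f` in `A_C` and `g` in `L¹`, as the derivative of `F ∗ g` for the
primitive `F` of `f`. -/
def AC.convL1 (f : AC) (g : ℝ → ℝ) (hg : Integrable g) : AC :=
  AC.primitive.symm (BC.conv (AC.primitive f) g hg)

lemma AC.primitive_convL1 (f : AC) {g : ℝ → ℝ} (hg : Integrable g) (x : ℝ) :
    (AC.primitive (f.convL1 g hg)).1 x = ∫ y, (AC.primitive f).1 (x - y) * g y := by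
  rw [AC.convL1, LinearEquiv.apply_symm_apply, BC.conv_apply]

lemma AC.norm_convL1_le (f : AC) {g : ℝ → ℝ} (hg : Integrable g) :
    ‖f.convL1 g hg‖ ≤ ‖f‖ * ∫ x, |g x| := by
  refine AC.norm_le_of_forall _ fun x y => ?_
  simp only [AC.primitive_convL1]
  rw [← integral_sub (BC.integrable_conv _ hg _) (BC.integrable_conv _ hg _), ← integral_const_mul]
  change ‖(_ : ℝ)‖ ≤ _
  refine norm_integral_le_of_norm_le (hg.abs.const_mul _) (ae_of_all _ fun z => ?_)
  rw [← sub_mul, Real.norm_eq_abs, abs_mul]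
  exact mul_le_mul_of_nonneg_right (f.abs_sub_le_norm _ _) (abs_nonneg _)

lemma AC.convL1_sub_right (f : AC) {g h : ℝ → ℝ} (hg : Integrable g) (hh : Integrable h) :
    f.convL1 g hg - f.convL1 h hh = f.convL1 (g - h) (hg.sub hh) := by
  refine AC.ext_primitive fun x => ?_
  rw [map_sub]
  change (AC.primitive (f.convL1 g hg)).1 x - (AC.primitive (f.convL1 h hh)).1 x = _
  simp only [AC.primitive_convL1]
  rw [← integral_sub (BC.integrable_conv _ hg _) (BC.integrable_conv _ hh _)]
  simp [mul_sub]

/-! ### Integration by parts for integrable functions of bounded variation -/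

/-- For a finite measure `P`, Fubini's theorem on a bounded interval gives an integration by parts
formula for the distribution function of `P`. The clamp `max a (min b s)` encodes the three
positions of the point `s` relative to `[a, b]`. -/
lemma intervalIntegral_deriv_mul_cdf (P : Measure ℝ) [IsFiniteMeasure P] {ψ ψ' : ℝ → ℝ}
    (hψ : ∀ x, HasDerivAt ψ (ψ' x) x) (hc : Continuous ψ') {a b : ℝ} (hab : a ≤ b) :
    ∫ y in a..b, ψ' y * P.real (Iic y) = ∫ s, (ψ b - ψ (max a (min b s))) ∂P := by
  have h1 : ∀ y, ψ' y * P.real (Iic y) = ∫ s, (Iic y).indicator (fun _ => ψ' y) s ∂P := fun y => by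
    rw [integral_indicator_const _ measurableSet_Iic, smul_eq_mul, mul_comm]
  have h2 : ∀ s, ∫ y in a..b, (Iic y).indicator (fun _ => ψ' y) s = ψ b - ψ (max a (min b s)) := by
    intro s
    rw [intervalIntegral.integral_of_le hab]
    have e : (fun y => (Iic y).indicator (fun _ => ψ' y) s) = (Ici s).indicator ψ' := by
      ext y
      simp [indicator_apply]
    have hle : max a (min b s) ≤ b := max_le hab (min_le_left _ _)
    rw [e, setIntegral_indicator measurableSet_Ici,
      ← intervalIntegral.integral_eq_sub_of_hasDerivAt (fun x _ => hψ x)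
      (hc.intervalIntegrable _ _), intervalIntegral.integral_of_le hle]
    refine setIntegral_congr_set ?_
    have h3 : (Ioc a b ∩ Ici s : Set ℝ) =ᵐ[volume] (Ioc a b ∩ Ioi s : Set ℝ) :=
      (ae_eq_refl _).inter Ioi_ae_eq_Ici.symm
    have h4 : Ioc a b ∩ Ioi s = Ioc (max a (min b s)) b := by
      ext y
      simp only [mem_inter_iff, mem_Ioc, mem_Ioi, max_lt_iff, min_lt_iff]
      constructor
      · rintro ⟨⟨h, h'⟩, h''⟩
        exact ⟨⟨h, Or.inr h''⟩, h'⟩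
      · rintro ⟨⟨h, h'⟩, h''⟩
        exact ⟨⟨h, h''⟩, h'.resolve_left h''.not_gt⟩
    rwa [h4] at h3
  simp_rw [h1, ← h2]
  rw [intervalIntegral.integral_of_le hab]
  simp_rw [intervalIntegral.integral_of_le hab]
  refine integral_integral_swap ?_
  have hm : MeasurableSet {p : ℝ × ℝ | p.2 ≤ p.1} := measurableSet_le measurable_snd measurable_fst
  have e : (Function.uncurry fun y s => (Iic y).indicator (fun _ => ψ' y) s) =
      {p : ℝ × ℝ | p.2 ≤ p.1}.indicator fun p => ψ' p.1 := by
    ext p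
    simp [indicator_apply, Function.uncurry]
  rw [e]
  refine Integrable.indicator ?_ hm
  have : Integrable ψ' (volume.restrict (Ioc a b)) := hc.integrableOn_Ioc
  exact this.comp_fst P

lemma limUnder_atBot_eq_zero {g : ℝ → ℝ} (hg : BoundedVariationOn g univ) (hi : Integrable g) :
    limUnder atBot g = 0 := by
  refine IntegrableAtFilter.eq_zero_of_tendsto (μ := volume) (hi.integrableAtFilter atBot)
    (fun s hs => ?_) hg.tendsto_atBot_limUnder
  obtain ⟨a, ha⟩ := mem_atBot_sets.1 hs
  exact top_le_iff.1 (Real.volume_Iic (a := a) ▸ measure_mono ha)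

lemma limUnder_atTop_eq_zero {g : ℝ → ℝ} (hg : BoundedVariationOn g univ) (hi : Integrable g) :
    limUnder atTop g = 0 := by
  refine IntegrableAtFilter.eq_zero_of_tendsto (μ := volume) (hi.integrableAtFilter atTop)
    (fun s hs => ?_) hg.tendsto_atTop_limUnder
  obtain ⟨a, ha⟩ := mem_atTop_sets.1 hs
  exact top_le_iff.1 (Real.volume_Ici (a := a) ▸ measure_mono ha)

/-- The Jordan decomposition of the Stieltjes measure of an integrable function `g` of bounded
variation: as `g` vanishes at `±∞`, the two parts have the same mass, and `g` is almost everywhere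
the difference of their distribution functions. -/
lemma exists_stieltjes_parts {g : ℝ → ℝ} (hg : BoundedVariationOn g univ) (hi : Integrable g) :
    ∃ P N : Measure ℝ, IsFiniteMeasure P ∧ IsFiniteMeasure N ∧
      P.real univ = N.real univ ∧
      (∀ᵐ y, g y = P.real (Iic y) - N.real (Iic y)) ∧
      ∀ u : ℝ → ℝ, Integrable u P → Integrable u N →
        ∫ᵛ y, u y ∂•hg.vectorMeasure = ∫ y, u y ∂P - ∫ y, u y ∂N := by
  set j := SignedMeasure.toJordanDecomposition hg.vectorMeasure
  have happ : ∀ s, MeasurableSet s → hg.vectorMeasure s = j.posPart.real s - j.negPart.real s :=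
    fun s hs => SignedMeasure.apply_eq_posPart_real_sub_negPart_real _ hs
  refine ⟨j.posPart, j.negPart, inferInstance, inferInstance, ?_, ?_, fun u hP hN => ?_⟩
  · have := happ univ MeasurableSet.univ
    rw [hg.vectorMeasure_univ, limUnder_atBot_eq_zero hg hi, limUnder_atTop_eq_zero hg hi] at this
    linarith
  · filter_upwards [hg.locallyBoundedVariationOn.ae_differentiableAt] with y hy
    rw [← happ _ measurableSet_Iic, hg.vectorMeasure_Iic, limUnder_atBot_eq_zero hg hi, sub_zero]
    exact (rightLim_eq_of_tendsto (hy.continuousAt.tendsto.mono_left nhdsWithin_le_nhds)).symm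
  · have e : hg.vectorMeasure = j.posPart.toSignedMeasure - j.negPart.toSignedMeasure :=
      (SignedMeasure.toSignedMeasure_toJordanDecomposition _).symm
    have eB : ContinuousLinearMap.lsmul ℝ ℝ = (ContinuousLinearMap.lsmul ℝ ℝ (E := ℝ)).flip := by
      ext
      simp
    rw [e, VectorMeasure.integral_sub_vectorMeasure, eB, VectorMeasure.integral_toSignedMeasure,
      VectorMeasure.integral_toSignedMeasure]
    · simpa [VectorMeasure.Integrable] using hP
    · simpa [VectorMeasure.Integrable] using hN

/-- Integration by parts `∫ ψ' g = -∫ ψ dg`. As `ψ'` need not be integrable, Fubini's theorem is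
applied on `[-n, n]`; the boundary terms at `+∞` cancel because `dg` has total mass `0`. -/
lemma integral_deriv_mul_eq_neg {g : ℝ → ℝ} (hi : Integrable g) {P N : Measure ℝ}
    [IsFiniteMeasure P] [IsFiniteMeasure N] (hPN : P.real univ = N.real univ)
    (hg : ∀ᵐ y, g y = P.real (Iic y) - N.real (Iic y)) {ψ ψ' : ℝ → ℝ}
    (hψ : ∀ x, HasDerivAt ψ (ψ' x) x) (hc : Continuous ψ') {C C' : ℝ} (hb : ∀ x, |ψ x| ≤ C)
    (hb' : ∀ x, |ψ' x| ≤ C') {l : ℝ} (hl : Tendsto ψ atTop (𝓝 l)) :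
    ∫ y, ψ' y * g y = -(∫ y, ψ y ∂P - ∫ y, ψ y ∂N) := by
  have hψc : Continuous ψ := continuous_iff_continuousAt.2 fun x => (hψ x).continuousAt
  have hn : Tendsto (fun n : ℕ => (n : ℝ)) atTop atTop := tendsto_natCast_atTop_atTop
  have hint : Integrable fun y => ψ' y * g y :=
    hi.bdd_mul hc.aestronglyMeasurable (ae_of_all _ hb')
  have key : ∀ (Q : Measure ℝ) [IsFiniteMeasure Q],
      Tendsto (fun n : ℕ => ∫ y in (-n : ℝ)..n, ψ' y * Q.real (Iic y)) atTop
        (𝓝 (l * Q.real univ - ∫ y, ψ y ∂Q)) := by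
    intro Q _
    have hψQ : Integrable ψ Q := Integrable.of_bound hψc.aestronglyMeasurable C (ae_of_all _ hb)
    have e : l * Q.real univ - ∫ y, ψ y ∂Q = ∫ y, (l - ψ y) ∂Q := by
      rw [integral_sub (integrable_const _) hψQ, integral_const, smul_eq_mul, mul_comm]
    simp_rw [intervalIntegral_deriv_mul_cdf Q hψ hc (neg_le_self (Nat.cast_nonneg _))]
    rw [e]
    refine tendsto_integral_of_dominated_convergence (fun _ => C + C) (fun n => ?_)
      (integrable_const _) (fun n => ae_of_all _ fun s => ?_) (ae_of_all _ fun s => ?_)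
    · exact (continuous_const.sub (hψc.comp (continuous_const.max
        (continuous_const.min continuous_id)))).aestronglyMeasurable
    · exact (abs_sub _ _).trans (add_le_add (hb _) (hb _))
    · refine (hl.comp hn).sub (tendsto_const_nhds.congr' ?_)
      filter_upwards [hn.eventually_ge_atTop |s|] with n hs
      rw [min_eq_right ((le_abs_self s).trans hs), max_eq_right (by linarith [neg_abs_le s])]
  have h1 := (key P).sub (key N)
  have h2 : Tendsto (fun n : ℕ => ∫ y in (-n : ℝ)..n, ψ' y * g y) atTop (𝓝 (∫ y, ψ' y * g y)) :=
    intervalIntegral_tendsto_integral hint (tendsto_neg_atTop_atBot.comp hn) hn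
  have hmon : ∀ (Q : Measure ℝ) [IsFiniteMeasure Q], Monotone fun y => Q.real (Iic y) :=
    fun Q _ x y h => measureReal_mono (Iic_subset_Iic.2 h)
  have hQ : ∀ (Q : Measure ℝ) [IsFiniteMeasure Q] (a b : ℝ),
      IntervalIntegrable (fun y => ψ' y * Q.real (Iic y)) volume a b := fun Q _ a b =>
    ((hmon Q).intervalIntegrable (μ := volume)).continuousOn_mul hc.continuousOn
  rw [hPN] at h1
  rw [tendsto_nhds_unique h2 (h1.congr fun n => ?_)]
  · ring
  · rw [← intervalIntegral.integral_sub (hQ P _ _) (hQ N _ _)]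
    refine intervalIntegral.integral_congr_ae ?_
    filter_upwards [hg] with y hy _
    rw [hy]
    ring

/-! ### Primitives of translates and reflections -/

lemma derivBC_apply (F : BC) (φ ψ : Test) (h : ∀ x, ψ x = deriv φ x) :
    derivBC F φ = -∫ x, ψ x * F.1 x := by
  rw [← ofFun_apply F.2.1]
  exact distDeriv_apply _ _ _ h

lemma AC.primitive_eq_of_apply (f : AC) (G : BC)
    (h : ∀ φ ψ : Test, (∀ x, ψ x = deriv φ x) → AC.toDist f φ = -∫ x, ψ x * G.1 x) :
    AC.primitive f = G := by
  refine AC.primitive_eq f G ?_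
  change derivBC G = _
  ext φ
  obtain ⟨ψ, hψ⟩ := exists_deriv φ
  rw [h φ ψ hψ, derivBC_apply G φ ψ hψ]

lemma AC.toDist_apply (f : AC) (φ ψ : Test) (h : ∀ x, ψ x = deriv φ x) :
    AC.toDist f φ = -∫ x, ψ x * (AC.primitive f).1 x := by
  rw [← AC.deriv_primitive]
  exact derivBC_apply _ _ _ h

lemma AC.primitive_translate (z : ℝ) (f : AC) (y : ℝ) :
    (AC.primitive (f.translate z)).1 y = (AC.primitive f).1 (y - z) := by
  obtain ⟨hF, hF0, L, hL⟩ := (AC.primitive f).2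
  have hG : Continuous fun y => (AC.primitive f).1 (y - z) :=
    hF.comp (continuous_id.sub continuous_const)
  let G : BC := ⟨fun y => (AC.primitive f).1 (y - z), hG,
    hF0.comp (tendsto_atBot_add_const_right _ (-z) tendsto_id),
    L, hL.comp (tendsto_atTop_add_const_right _ (-z) tendsto_id)⟩
  rw [AC.primitive_eq_of_apply (f.translate z) G fun φ ψ hψ => ?_]
  change AC.toDist f (testTranslate (-z) φ) = _
  rw [AC.toDist_apply f _ (testTranslate (-z) ψ),
    ← integral_sub_right_eq_self (fun y => testTranslate (-z) ψ y * (AC.primitive f).1 y) z]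
  · simp [testTranslate_apply, G]
  · intro y
    rw [testTranslate_apply, hψ]
    exact (deriv_comp_sub_const (f := φ) (-z) y).symm

lemma integral_deriv_test (φ ψ : Test) (h : ∀ x, ψ x = deriv φ x) : ∫ y, ψ y = 0 := by
  refine integral_eq_zero_of_hasDerivAt_of_integrable (f := φ) (fun y => ?_)
    (ψ.continuous.integrable_of_hasCompactSupport ψ.hasCompactSupport)
    (φ.continuous.integrable_of_hasCompactSupport φ.hasCompactSupport)
  rw [h]
  exact ((φ.contDiff.differentiable (by simp)) y).hasDerivAt

lemma AC.primitive_reflect (x : ℝ) (f : AC) {L : ℝ}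
    (hL : Tendsto (AC.primitive f).1 atTop (𝓝 L)) (y : ℝ) :
    (AC.primitive (f.reflect x)).1 y = L - (AC.primitive f).1 (x - y) := by
  obtain ⟨hF, hF0, -⟩ := (AC.primitive f).2
  have hG : Continuous fun y => L - (AC.primitive f).1 (x - y) :=
    continuous_const.sub (hF.comp (continuous_const.sub continuous_id))
  let G : BC := ⟨fun y => L - (AC.primitive f).1 (x - y), hG, by
      simpa using! tendsto_const_nhds.sub
        (hL.comp (tendsto_atTop_add_const_left _ x tendsto_neg_atBot_atTop)) (a := L), L, by
      simpa using! tendsto_const_nhds.sub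
        (hF0.comp (tendsto_atBot_add_const_left _ x tendsto_neg_atTop_atBot)) (a := L)⟩
  rw [AC.primitive_eq_of_apply (f.reflect x) G fun φ ψ hψ => ?_]
  change AC.toDist f (testReflect x φ) = _
  have i1 : Integrable fun y => ψ y * L :=
    (ψ.continuous.mul continuous_const).integrable_of_hasCompactSupport
      ψ.hasCompactSupport.mul_right
  have i2 : Integrable fun y => ψ y * (AC.primitive f).1 (x - y) :=
    (ψ.continuous.mul (hF.comp (continuous_const.sub continuous_id))
      ).integrable_of_hasCompactSupport ψ.hasCompactSupport.mul_right
  rw [AC.toDist_apply f _ (-testReflect x ψ), ← integral_sub_left_eq_self _ volume x]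
  · have h1 : ∀ y, (-testReflect x ψ) (x - y) * (AC.primitive f).1 (x - y) =
        -(ψ y * (AC.primitive f).1 (x - y)) := fun y => by
      change -(testReflect x ψ) (x - y) * (AC.primitive f).1 (x - y) = _
      rw [testReflect_apply, sub_sub_cancel, neg_mul]
    simp only [h1, G, mul_sub]
    rw [integral_sub i1 i2, integral_mul_const, integral_deriv_test φ ψ hψ, integral_neg]
    ring
  · intro y
    change -(testReflect x ψ) y = _
    have : (testReflect x φ : ℝ → ℝ) = fun y => φ (x - y) := funext (testReflect_apply x φ)
    rw [testReflect_apply, hψ, this, deriv_comp_const_sub]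

/-! ### Convolution with an integrable function of bounded variation -/

/-- For `g` integrable and of bounded variation, `F ∗ g` is continuously differentiable with
derivative `f ∗ g`. Integrating `f ∗ g = ∫ F (x - y) dg(y)` over `[a, b]` and exchanging the
integrals leaves the Stieltjes integral of `y ↦ ∫_{a - y}^{b - y} F`, which is integrated by
parts. -/
lemma AC.intervalIntegral_convBV (f : AC) {g : ℝ → ℝ} (hg : BoundedVariationOn g univ)
    (hi : Integrable g) :
    Continuous (f.convBV g) ∧ ∀ a b : ℝ, ∫ x in a..b, f.convBV g x =
      (AC.primitive (f.convL1 g hi)).1 b - (AC.primitive (f.convL1 g hi)).1 a := by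
  obtain ⟨P, N, hP, hN, hPN, hae, hint⟩ := exists_stieltjes_parts hg hi
  set F := AC.primitive f
  obtain ⟨hF, hF0, L, hL⟩ := F.2
  obtain ⟨C, hC⟩ := BC.exists_abs_le F
  have hsub : ∀ x : ℝ, Continuous fun y => F.1 (x - y) := fun x =>
    hF.comp (continuous_const.sub continuous_id)
  have hiQ : ∀ (Q : Measure ℝ) [IsFiniteMeasure Q] (x : ℝ), Integrable (fun y => F.1 (x - y)) Q :=
    fun Q _ x => Integrable.of_bound (hsub x).aestronglyMeasurable C (ae_of_all _ fun y => hC _)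
  have htop : extend g ⊤ = 0 :=
    extend_top (limUnder_atTop_eq_zero hg hi ▸ hg.tendsto_atTop_limUnder)
  have hk : ∀ x, f.convBV g x = ∫ y, F.1 (x - y) ∂P - ∫ y, F.1 (x - y) ∂N := by
    intro x
    have e : (AC.primitive (f.reflect x)).1 = fun y => L - F.1 (x - y) :=
      funext (AC.primitive_reflect x f hL)
    rw [AC.convBV, AC.integralMul, dif_pos hg, htop, mul_zero, zero_sub, e,
      hint (fun y => L - F.1 (x - y)) ((integrable_const _).sub (hiQ P x))
        ((integrable_const _).sub (hiQ N x)),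
      integral_sub (integrable_const _) (hiQ P x), integral_sub (integrable_const _) (hiQ N x),
      integral_const, integral_const, hPN]
    ring
  have hcQ : ∀ (Q : Measure ℝ) [IsFiniteMeasure Q], Continuous fun x => ∫ y, F.1 (x - y) ∂Q :=
    fun Q _ => continuous_of_dominated (bound := fun _ => C)
      (fun x => (hsub x).aestronglyMeasurable) (fun x => ae_of_all _ fun y => hC _)
      (integrable_const _) (ae_of_all _ fun y => hF.comp (continuous_id.sub continuous_const))
  refine ⟨by rw [funext hk]; exact (hcQ P).sub (hcQ N), ?_⟩
  suffices ∀ a b : ℝ, a ≤ b → ∫ x in a..b, f.convBV g x =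
      (AC.primitive (f.convL1 g hi)).1 b - (AC.primitive (f.convL1 g hi)).1 a by
    intro a b
    rcases le_total a b with h | h
    · exact this a b h
    · rw [intervalIntegral.integral_symm, this b a h]
      ring
  intro a b hab
  have hFi : ∀ c d : ℝ, IntervalIntegrable F.1 volume c d := fun c d => hF.intervalIntegrable c d
  set ψ : ℝ → ℝ := fun y => ∫ x in a..b, F.1 (x - y)
  have hψ' : ∀ y, HasDerivAt ψ (F.1 (a - y) - F.1 (b - y)) y := by
    intro y
    set Φ : ℝ → ℝ := fun x => ∫ u in (0 : ℝ)..x, F.1 u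
    have hΦ : ∀ x, HasDerivAt Φ (F.1 x) x := fun x =>
      intervalIntegral.integral_hasDerivAt_right (hFi 0 x)
        hF.aestronglyMeasurable.stronglyMeasurableAtFilter hF.continuousAt
    have e : ψ = fun y => Φ (b - y) - Φ (a - y) := by
      ext y
      simp only [ψ, Φ]
      rw [intervalIntegral.integral_comp_sub_right (fun x => F.1 x) y,
        intervalIntegral.integral_interval_sub_left (hFi _ _) (hFi _ _)]
    rw [e]
    have := ((hΦ (b - y)).comp_const_sub b y).sub ((hΦ (a - y)).comp_const_sub a y)
    exact this.congr_deriv (by ring)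
  have hbound : ∀ y, ‖ψ y‖ ≤ C * |b - a| := fun y =>
    intervalIntegral.norm_integral_le_of_norm_le_const fun x _ => hC _
  have hlim : Tendsto ψ atTop (𝓝 0) := by
    have : Tendsto ψ atTop (𝓝 (∫ x in a..b, (0 : ℝ))) := by
      refine intervalIntegral.tendsto_integral_filter_of_dominated_convergence (fun _ => C)
        (Eventually.of_forall fun y =>
          (hF.comp (continuous_id.sub continuous_const)).aestronglyMeasurable)
        (Eventually.of_forall fun y => ae_of_all _ fun x _ => hC _) (by simp)
        (ae_of_all _ fun x _ =>
          hF0.comp (tendsto_atBot_add_const_left _ x tendsto_neg_atTop_atBot))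
    simpa using this
  have hibp := integral_deriv_mul_eq_neg hi hPN hae hψ' ((hsub a).sub (hsub b)) hbound
    (C' := C + C) (fun y => (abs_sub _ _).trans (add_le_add (hC _) (hC _))) hlim
  have hswap : ∀ (Q : Measure ℝ) [IsFiniteMeasure Q],
      ∫ x in a..b, ∫ y, F.1 (x - y) ∂Q = ∫ y, ψ y ∂Q := by
    intro Q _
    simp only [ψ, intervalIntegral.integral_of_le hab]
    refine integral_integral_swap (Integrable.of_bound (C := C) ?_ (ae_of_all _ fun p => hC _))
    exact (hF.comp (continuous_fst.sub continuous_snd)).aestronglyMeasurable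
  simp_rw [hk]
  rw [intervalIntegral.integral_sub ((hcQ P).intervalIntegrable _ _)
    ((hcQ N).intervalIntegrable _ _), hswap P, hswap N, AC.primitive_convL1, AC.primitive_convL1,
    ← integral_sub (BC.integrable_conv F hi b) (BC.integrable_conv F hi a),
    ← neg_eq_iff_eq_neg.2 hibp, ← integral_neg]
  congr 1
  ext y
  ring

/-- For integrable `g` of bounded variation, the two descriptions of `f ∗ g` agree. -/
lemma AC.toDist_convL1_eq_ofFun (f : AC) {g : ℝ → ℝ} (hg : BoundedVariationOn g univ)
    (hi : Integrable g) : AC.toDist (f.convL1 g hi) = ofFun (f.convBV g) := by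
  obtain ⟨hc, hk⟩ := f.intervalIntegral_convBV hg hi
  set G := AC.primitive (f.convL1 g hi)
  have hG : ∀ x, HasDerivAt G.1 (f.convBV g x) x := by
    intro x
    have e : G.1 = fun x => (∫ u in (0 : ℝ)..x, f.convBV g u) + G.1 0 := by
      ext x
      rw [hk]
      ring
    rw [e]
    exact (intervalIntegral.integral_hasDerivAt_right (hc.intervalIntegrable 0 x)
      hc.aestronglyMeasurable.stronglyMeasurableAtFilter hc.continuousAt).add_const _
  ext φ
  obtain ⟨ψ, hψ⟩ := exists_deriv φ
  rw [AC.toDist_apply _ φ ψ hψ, ofFun_apply hc]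
  rw [integral_mul_deriv_eq_deriv_mul_of_integrable (u := φ) (v := G.1) (u' := ψ)
    (fun x _ => ?_) (fun x _ => hG x)]
  · exact (φ.continuous.mul hc).integrable_of_hasCompactSupport φ.hasCompactSupport.mul_right
  · exact (ψ.continuous.mul G.2.1).integrable_of_hasCompactSupport ψ.hasCompactSupport.mul_right
  · exact (φ.continuous.mul G.2.1).integrable_of_hasCompactSupport φ.hasCompactSupport.mul_right
  · rw [hψ]
    exact ((φ.contDiff.differentiable (by simp)) x).hasDerivAt

/-! ### The convolution is well defined -/

/-- Elements of `BV ∩ L¹` approximating `g` have convolutions with `f` approximating that of `g`, by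
the norm estimate applied to the differences. -/
lemma AC.isConv_convL1 (f : AC) {g : ℝ → ℝ} (hg : Integrable g) :
    f.IsConv g (f.convL1 g hg) := by
  intro gs hgs hlim
  refine ⟨fun n => f.convL1 (gs n) (hgs n).2,
    fun n => f.toDist_convL1_eq_ofFun (hgs n).1 (hgs n).2, ?_⟩
  refine squeeze_zero (fun n => norm_nonneg _) (fun n => ?_)
    (by simpa using hlim.const_mul ‖f‖)
  rw [AC.convL1_sub_right]
  exact AC.norm_convL1_le _ _

lemma boundedVariationOn_of_contDiff {g : ℝ → ℝ} (hg : ContDiff ℝ ∞ g) (hc : HasCompactSupport g) :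
    BoundedVariationOn g univ := by
  obtain ⟨C, hC⟩ := hg.lipschitzWith_of_hasCompactSupport hc (by simp)
  obtain ⟨R, hR⟩ := hc.isCompact.isBounded.subset_closedBall (0 : ℝ)
  -- `g` factors through the monotone retraction of the line onto an interval containing its
  -- support in the interior
  have e : g = g ∘ fun x => max (-(|R| + 1)) (min (|R| + 1) x) := by
    ext x
    have h0 : ∀ y, |R| + 1 ≤ |y| → g y = 0 := by
      intro y hy
      by_contra h
      have := hR (subset_tsupport _ h)
      rw [Metric.mem_closedBall, dist_zero_right, Real.norm_eq_abs] at this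
      linarith [le_abs_self R]
    have hR0 := abs_nonneg R
    simp only [Function.comp]
    rcases le_total x (-(|R| + 1)) with h | h
    · rw [min_eq_right (by linarith), max_eq_left h,
        h0 x ((le_neg_of_le_neg h).trans (neg_le_abs x)),
        h0 _ (by rw [abs_neg]; exact le_abs_self _)]
    · rcases le_total x (|R| + 1) with h' | h'
      · rw [min_eq_right h', max_eq_right h]
      · rw [min_eq_left h', max_eq_right (by linarith), h0 x (h'.trans (le_abs_self x)),
          h0 _ (le_abs_self _)]
  have hb : BoundedVariationOn g (Icc (-(|R| + 1)) (|R| + 1)) := by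
    have hR0 := abs_nonneg R
    have := hC.locallyBoundedVariationOn univ (-(|R| + 1)) (|R| + 1) (mem_univ _) (mem_univ _)
    rwa [univ_inter] at this
  rw [e]
  refine ne_top_of_le_ne_top hb (eVariationOn.comp_le_of_monotoneOn g _ (fun x _ y _ h => ?_) ?_)
  · exact max_le_max le_rfl (min_le_min le_rfl h)
  · intro x _
    have hR0 := abs_nonneg R
    exact ⟨le_max_left _ _, max_le (by linarith) (min_le_left _ _)⟩

lemma exists_seq_boundedVariationOn {g : ℝ → ℝ} (hg : Integrable g) :
    ∃ gs : ℕ → ℝ → ℝ, (∀ n, BoundedVariationOn (gs n) univ ∧ Integrable (gs n)) ∧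
      Tendsto (fun n => ∫ x, |gs n x - g x|) atTop (𝓝 0) := by
  have h : ∀ n : ℕ, ∃ h : ℝ → ℝ, HasCompactSupport h ∧ ContDiff ℝ ∞ h ∧
      eLpNorm (g - h) 1 volume ≤ ENNReal.ofReal (1 / (n + 1)) := fun n =>
    (memLp_one_iff_integrable.2 hg).exist_eLpNorm_sub_le ENNReal.one_ne_top le_rfl (by positivity)
  choose gs hs hd hl using h
  have hi : ∀ n, Integrable (gs n) := fun n =>
    (hd n).continuous.integrable_of_hasCompactSupport (hs n)
  refine ⟨gs, fun n => ⟨boundedVariationOn_of_contDiff (hd n) (hs n), hi n⟩,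
    squeeze_zero (fun n => integral_nonneg fun x => abs_nonneg _) (fun n => ?_)
      tendsto_one_div_add_atTop_nhds_zero_nat⟩
  have h1 : ∫ x, |gs n x - g x| = (eLpNorm (g - gs n) 1 volume).toReal := by
    rw [eLpNorm_one_eq_lintegral_enorm,
      ← integral_norm_eq_lintegral_enorm (hg.sub (hi n)).aestronglyMeasurable]
    congr 1
    ext x
    rw [abs_sub_comm]
    rfl
  rw [h1]
  exact ENNReal.toReal_le_of_le_ofReal (by positivity) (hl n)

/-- Uniqueness of the limit, as `BV ∩ L¹` is dense in `L¹`. -/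
lemma AC.IsConv.unique {f k l : AC} {g : ℝ → ℝ} (hg : Integrable g) (hk : f.IsConv g k)
    (hl : f.IsConv g l) : k = l := by
  obtain ⟨gs, hgs, hlim⟩ := exists_seq_boundedVariationOn hg
  obtain ⟨ks, hks, hk'⟩ := hk gs hgs hlim
  obtain ⟨ls, hls, hl'⟩ := hl gs hgs hlim
  have e : ks = ls := funext fun n => AC.toDist_injective ((hks n).trans (hls n).symm)
  rw [← e] at hl'
  exact tendsto_nhds_unique (tendsto_iff_norm_sub_tendsto_zero.2 hk')
    (tendsto_iff_norm_sub_tendsto_zero.2 hl')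

lemma AC.isConv_conv (f : AC) {g : ℝ → ℝ} (hg : Integrable g) : f.IsConv g (f.conv g) := by
  have h : ∃ k, f.IsConv g k := ⟨_, f.isConv_convL1 hg⟩
  rw [AC.conv, dif_pos h]
  exact h.choose_spec

lemma AC.conv_eq_convL1 (f : AC) {g : ℝ → ℝ} (hg : Integrable g) : f.conv g = f.convL1 g hg :=
  (f.isConv_conv hg).unique hg (f.isConv_convL1 hg)

/-- The primitive of `f ∗ g` is `F ∗ g`. -/
lemma AC.primitive_conv (f : AC) {g : ℝ → ℝ} (hg : Integrable g) (x : ℝ) :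
    (AC.primitive (f.conv g)).1 x = ∫ y, (AC.primitive f).1 (x - y) * g y := by
  rw [f.conv_eq_convL1 hg, AC.primitive_convL1]

/-! ### Algebraic properties and the norm estimate -/

lemma AC.norm_conv_le (f : AC) {g : ℝ → ℝ} (hg : Integrable g) :
    ‖f.conv g‖ ≤ ‖f‖ * ∫ x, |g x| := by
  rw [f.conv_eq_convL1 hg]
  exact f.norm_convL1_le hg

open scoped Convolution in
/-- For primitives this is `(h ∗ g) ∗ F = h ∗ (g ∗ F)`, associativity of the classical
convolution. -/
lemma AC.conv_conv (f : AC) {g h : ℝ → ℝ} (hg : Integrable g) (hh : Integrable h) :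
    (f.conv g).conv h = f.conv (g ⋆[ContinuousLinearMap.mul ℝ ℝ, volume] h) := by
  set B := ContinuousLinearMap.mul ℝ ℝ
  have hgh : Integrable (g ⋆[B, volume] h) := hg.integrable_convolution B hh
  refine AC.ext_primitive fun x => ?_
  set F := AC.primitive f
  obtain ⟨C, hC⟩ := BC.exists_abs_le F
  have e1 : (AC.primitive ((f.conv g).conv h)).1 x = (h ⋆[B, volume] (g ⋆[B, volume] F.1)) x := by
    rw [AC.primitive_conv _ hh]
    refine integral_congr_ae (ae_of_all _ fun y => ?_)
    simp only [AC.primitive_conv _ hg]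
    rw [ContinuousLinearMap.mul_apply', mul_comm]
    congr 1
    refine integral_congr_ae (ae_of_all _ fun z => ?_)
    exact mul_comm _ _
  have e2 : (AC.primitive (f.conv (g ⋆[B, volume] h))).1 x =
      ((h ⋆[B, volume] g) ⋆[B, volume] F.1) x := by
    rw [AC.primitive_conv _ hgh]
    refine integral_congr_ae (ae_of_all _ fun y => ?_)
    have e : (g ⋆[B, volume] h) y = (h ⋆[B, volume] g) y := by
      rw [convolution_mul_swap]
      exact integral_congr_ae (ae_of_all _ fun z => mul_comm _ _)
    change F.1 (x - y) * (g ⋆[B, volume] h) y = (h ⋆[B, volume] g) y * F.1 (x - y)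
    rw [e, mul_comm]
  rw [e1, e2]
  refine (convolution_assoc' B B B B (fun a b c => mul_assoc a b c)
    (hh.ae_convolution_exists B hg) (ae_of_all _ fun y => ?_) ?_).symm
  · refine (BC.integrable_conv F hg y).congr (ae_of_all _ fun z => ?_)
    exact mul_comm _ _
  · have := (hh.convolution_integrand B hg).bdd_mul (c := C)
      (f := fun p : ℝ × ℝ => F.1 (x - p.1))
      (F.2.1.comp (continuous_const.sub continuous_fst)).aestronglyMeasurable
      (ae_of_all _ fun p => hC _)
    refine this.congr (ae_of_all _ fun p => ?_)
    simp only [Function.uncurry, B, ContinuousLinearMap.mul_apply']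
    ring

lemma AC.translate_conv (f : AC) {g : ℝ → ℝ} (hg : Integrable g) (z : ℝ) :
    (f.conv g).translate z = (f.translate z).conv g := by
  refine AC.ext_primitive fun x => ?_
  simp only [AC.primitive_translate, AC.primitive_conv _ hg, sub_right_comm]

lemma AC.translate_conv_right (f : AC) {g : ℝ → ℝ} (hg : Integrable g) (z : ℝ) :
    (f.conv g).translate z = f.conv fun x => g (x - z) := by
  refine AC.ext_primitive fun x => ?_
  rw [AC.primitive_translate, AC.primitive_conv _ hg, AC.primitive_conv _ (hg.comp_sub_right z),
    ← integral_sub_right_eq_self _ z]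
  simp

lemma AC.conv_congr_ae (f : AC) {g h : ℝ → ℝ} (hg : Integrable g) (e : g =ᵐ[volume] h) :
    f.conv g = f.conv h := by
  refine AC.ext_primitive fun x => ?_
  rw [AC.primitive_conv _ hg, AC.primitive_conv _ (hg.congr e)]
  exact integral_congr_ae (e.mono fun y hy => by simp only [hy])

lemma AC.conv_add (f : AC) {g h : ℝ → ℝ} (hg : Integrable g) (hh : Integrable h) :
    f.conv (g + h) = f.conv g + f.conv h := by
  refine AC.ext_primitive fun x => ?_
  rw [map_add]
  change _ = (AC.primitive (f.conv g)).1 x + (AC.primitive (f.conv h)).1 x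
  rw [AC.primitive_conv _ hg, AC.primitive_conv _ hh, AC.primitive_conv _ (hg.add hh),
    ← integral_add (BC.integrable_conv _ hg x) (BC.integrable_conv _ hh x)]
  simp [mul_add]

lemma AC.conv_smul (f : AC) {g : ℝ → ℝ} (hg : Integrable g) (c : ℝ) :
    f.conv (c • g) = c • f.conv g := by
  refine AC.ext_primitive fun x => ?_
  rw [map_smul]
  change _ = c * (AC.primitive (f.conv g)).1 x
  rw [AC.primitive_conv _ hg, AC.primitive_conv _ (hg.smul c), ← integral_const_mul]
  simp [mul_left_comm]

lemma AC.add_conv (e f : AC) {g : ℝ → ℝ} (hg : Integrable g) :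
    (e + f).conv g = e.conv g + f.conv g := by
  refine AC.ext_primitive fun x => ?_
  rw [map_add]
  change _ = (AC.primitive (e.conv g)).1 x + (AC.primitive (f.conv g)).1 x
  rw [AC.primitive_conv _ hg, AC.primitive_conv _ hg, AC.primitive_conv _ hg,
    ← integral_add (BC.integrable_conv _ hg x) (BC.integrable_conv _ hg x), map_add]
  simp [add_mul]

lemma AC.smul_conv (f : AC) {g : ℝ → ℝ} (hg : Integrable g) (c : ℝ) :
    (c • f).conv g = c • f.conv g := by
  refine AC.ext_primitive fun x => ?_
  rw [map_smul]
  change _ = c * (AC.primitive (f.conv g)).1 x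
  rw [AC.primitive_conv _ hg, AC.primitive_conv _ hg, ← integral_const_mul, map_smul]
  simp [mul_assoc]

/-! ### The convolution operators -/

lemma AC.norm_conv_Lp_le (f : AC) (g : ℝ →₁[volume] ℝ) : ‖f.conv g‖ ≤ ‖f‖ * ‖g‖ := by
  rw [L1.norm_eq_integral_norm]
  exact f.norm_conv_le (L1.integrable_coeFn g)

/-- The operator `g ↦ f ∗ g` from `L¹` to `A_C`. -/
def AC.convRight (f : AC) : (ℝ →₁[volume] ℝ) →L[ℝ] AC :=
  LinearMap.mkContinuous
    { toFun := fun g => f.conv g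
      map_add' := fun g h => by
        rw [← f.conv_add (L1.integrable_coeFn g) (L1.integrable_coeFn h)]
        exact f.conv_congr_ae (L1.integrable_coeFn _) (Lp.coeFn_add g h)
      map_smul' := fun c g => by
        rw [RingHom.id_apply, ← f.conv_smul (L1.integrable_coeFn g)]
        exact f.conv_congr_ae (L1.integrable_coeFn _) (Lp.coeFn_smul c g) }
    ‖f‖ f.norm_conv_Lp_le

lemma AC.convRight_apply (f : AC) (g : ℝ →₁[volume] ℝ) : f.convRight g = f.conv g := rfl

lemma AC.norm_convRight_le (f : AC) : ‖f.convRight‖ ≤ ‖f‖ :=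
  LinearMap.mkContinuous_norm_le _ (norm_nonneg _) _

/-- The operator `f ↦ f ∗ g` on `A_C`. -/
def AC.convLeft (g : ℝ →₁[volume] ℝ) : AC →L[ℝ] AC :=
  LinearMap.mkContinuous
    { toFun := fun f => f.conv g
      map_add' := fun e f => e.add_conv f (L1.integrable_coeFn g)
      map_smul' := fun c f => f.smul_conv (L1.integrable_coeFn g) c }
    ‖g‖ fun f => by
      rw [mul_comm]
      exact f.norm_conv_Lp_le g

lemma AC.convLeft_apply (g : ℝ →₁[volume] ℝ) (f : AC) : AC.convLeft g f = f.conv g := rfl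

lemma AC.norm_convLeft_le (g : ℝ →₁[volume] ℝ) : ‖AC.convLeft g‖ ≤ ‖g‖ :=
  LinearMap.mkContinuous_norm_le _ (norm_nonneg _) _

lemma tendsto_max_min_atTop : Tendsto (fun x : ℝ => max 0 (min x 1)) atTop (𝓝 1) :=
  tendsto_const_nhds.congr' ((eventually_ge_atTop 1).mono fun x hx => by
    simp only [min_eq_right hx, max_eq_right zero_le_one])

/-- The primitive of the indicator function of `[0, 1]`. -/
def ramp : BC :=
  ⟨fun x => max 0 (min x 1), continuous_const.max (continuous_id.min continuous_const),
    tendsto_const_nhds.congr' ((eventually_le_atBot 0).mono fun x hx =>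
      (max_eq_left ((min_le_left x 1).trans hx)).symm), 1, tendsto_max_min_atTop⟩

lemma tendsto_ramp_atTop : Tendsto ramp.1 atTop (𝓝 1) := tendsto_max_min_atTop

/-- With `f` and `g` both the indicator function of `[0, 1]`, all of `‖f‖`, `‖g‖₁` and
`|∫ f ∗ g|` are `1`, so that the norm estimate for the convolution is sharp. -/
lemma exists_norm_conv_eq : ∃ (f : AC) (g : ℝ →₁[volume] ℝ),
    ‖f‖ = 1 ∧ ‖g‖ = 1 ∧ 1 ≤ ‖f.conv g‖ := by
  set f : AC := AC.primitive.symm ramp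
  have hf : AC.primitive f = ramp := LinearEquiv.apply_symm_apply _ _
  set g : ℝ →₁[volume] ℝ := indicatorConstLp 1 (measurableSet_Icc (a := (0 : ℝ)) (b := 1))
    (by simp) (1 : ℝ)
  have hg : ∫ x, g x = 1 := by
    rw [integral_congr_ae indicatorConstLp_coeFn, integral_indicator_const _ measurableSet_Icc]
    simp
  refine ⟨f, g, le_antisymm (f.norm_le_of_forall fun x y => ?_) ?_, ?_, ?_⟩
  · have h0 : ∀ x, 0 ≤ ramp.1 x ∧ ramp.1 x ≤ 1 := fun x =>
      ⟨le_max_left _ _, max_le zero_le_one (min_le_right _ _)⟩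
    rw [hf, abs_le]
    constructor <;> linarith [(h0 x).1, (h0 x).2, (h0 y).1, (h0 y).2]
  · have := f.abs_extend_top_le_norm
    rwa [hf, extend_top tendsto_ramp_atTop, abs_one] at this
  · rw [norm_indicatorConstLp one_ne_zero ENNReal.one_ne_top]
    simp
  · have htop : Tendsto (BC.conv ramp g (L1.integrable_coeFn g)).1 atTop (𝓝 (1 * ∫ x, g x)) :=
      BC.tendsto_conv_atTop ramp (L1.integrable_coeFn g) tendsto_ramp_atTop
    have := (f.conv g).abs_extend_top_le_norm
    rw [f.conv_eq_convL1 (L1.integrable_coeFn g), AC.convL1, LinearEquiv.apply_symm_apply, hf,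
      extend_top htop, hg] at this
    rw [f.conv_eq_convL1 (L1.integrable_coeFn g), AC.convL1, hf]
    simpa using this

/-! ### Approximate identities -/

lemma integral_dilate (g : ℝ → ℝ) {t : ℝ} (ht : 0 < t) : ∫ x, dilate g t x = ∫ x, g x := by
  simp only [dilate]
  rw [integral_div, Measure.integral_comp_div, abs_of_pos ht, smul_eq_mul]
  field_simp

lemma integrable_dilate {g : ℝ → ℝ} (hg : Integrable g) {t : ℝ} (ht : 0 < t) :
    Integrable (dilate g t) :=
  (hg.comp_div ht.ne').div_const t

lemma AC.primitive_conv_dilate (f : AC) {g : ℝ → ℝ} (hg : Integrable g) {t : ℝ} (ht : 0 < t)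
    (x : ℝ) : (AC.primitive (f.conv (dilate g t))).1 x =
      ∫ y, (AC.primitive f).1 (x - t * y) * g y := by
  rw [AC.primitive_conv _ (integrable_dilate hg ht), 
    ← integral_dilate (fun y => (AC.primitive f).1 (x - t * y) * g y) ht]
  congr 1
  ext y
  simp only [dilate, mul_div_cancel₀ y ht.ne', mul_div_assoc]

/-- Subtracting the Lipschitz function `F(∞) * ramp` from `F` leaves a continuous function that
vanishes at infinity. -/
lemma BC.uniformContinuous (F : BC) : UniformContinuous F.1 := by
  obtain ⟨hF, hF0, L, hL⟩ := F.2
  have hr : UniformContinuous fun x => L * ramp.1 x := by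
    have h1 : LipschitzWith 1 ramp.1 := (LipschitzWith.id.min_const 1).const_max 0
    exact (uniformContinuous_const_smul L).comp h1.uniformContinuous
  have h0 : UniformContinuous fun x => F.1 x - L * ramp.1 x := by
    refine Continuous.uniformContinuous_of_tendsto_cocompact (x := 0)
      (hF.sub (continuous_const.mul ramp.2.1)) ?_
    rw [cocompact_eq_atBot_atTop, tendsto_sup]
    exact ⟨by simpa using hF0.sub (ramp.2.2.1.const_mul L),
      by simpa using hL.sub (tendsto_ramp_atTop.const_mul L)⟩
  simpa using h0.add hr

/-- The primitive of `f ∗ g_t - (∫ g) f` is `∫ (F (x - t y) - F x) g(y) dy`. Uniform convergence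
to `0` is convergence along the product of `t → 0⁺` with the trivial filter in `x`, to which
dominated convergence applies directly by uniform continuity of `F`. -/
lemma AC.tendsto_conv_dilate (f : AC) {g : ℝ → ℝ} (hg : Integrable g) :
    Tendsto (fun t : ℝ => ‖f.conv (dilate g t) - (∫ x, g x) • f‖) (𝓝[>] 0) (𝓝 0) := by
  set F := AC.primitive f
  obtain ⟨C, hC⟩ := BC.exists_abs_le F
  have h1 : Tendsto (fun p : ℝ × ℝ => ∫ y, (F.1 (p.2 - p.1 * y) - F.1 p.2) * g y)
      (𝓝[>] 0 ×ˢ ⊤) (𝓝 (∫ y : ℝ, (0 : ℝ))) := by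
    have : (⊤ : Filter ℝ).IsCountablyGenerated := by
      rw [← principal_univ]
      infer_instance
    refine tendsto_integral_filter_of_dominated_convergence (fun y => (C + C) * |g y|)
      (Eventually.of_forall fun p => ?_) (Eventually.of_forall fun p => ae_of_all _ fun y => ?_)
      (hg.abs.const_mul _) (ae_of_all _ fun y => ?_)
    · exact ((F.2.1.comp (continuous_const.sub (continuous_const.mul continuous_id))).sub
        continuous_const).aestronglyMeasurable.mul hg.aestronglyMeasurable
    · rw [Real.norm_eq_abs, abs_mul]
      exact mul_le_mul_of_nonneg_right ((abs_sub _ _).trans (add_le_add (hC _) (hC _)))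
        (abs_nonneg _)
    · have : Tendsto (fun p : ℝ × ℝ => F.1 (p.2 - p.1 * y) - F.1 p.2) (𝓝[>] 0 ×ˢ ⊤) (𝓝 0) := by
        rw [Metric.tendsto_nhds]
        intro ε hε
        obtain ⟨δ, hδ, h⟩ := Metric.uniformContinuous_iff.1 (BC.uniformContinuous F) ε hε
        have h2 : Tendsto (fun t : ℝ => t * y) (𝓝[>] 0) (𝓝 0) := by
          have : Tendsto (fun t : ℝ => t * y) (𝓝 0) (𝓝 (0 * y)) := tendsto_id.mul_const y
          rw [zero_mul] at this
          exact this.mono_left nhdsWithin_le_nhds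
        filter_upwards [(h2.eventually (Metric.ball_mem_nhds 0 hδ)).prod_inl ⊤] with p hp
        rw [dist_zero_right, ← dist_eq_norm]
        refine h ?_
        simpa [Real.dist_eq] using hp
      simpa using this.mul_const (g y)
  rw [integral_zero] at h1
  have h2 : TendstoUniformly (fun t x => ∫ y, (F.1 (x - t * y) - F.1 x) * g y) (fun _ => 0)
      (𝓝[>] 0) := tendsto_prod_top_iff.1 h1
  rw [Metric.tendstoUniformly_iff] at h2
  rw [Metric.tendsto_nhds]
  intro ε hε
  filter_upwards [h2 (ε / 3) (by positivity), self_mem_nhdsWithin] with t ht ht0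
  rw [dist_zero_right, norm_norm]
  have hD : ∀ x, |(AC.primitive (f.conv (dilate g t) - (∫ x, g x) • f)).1 x| ≤ ε / 3 := by
    intro x
    have e : (AC.primitive (f.conv (dilate g t) - (∫ x, g x) • f)).1 x =
        ∫ y, (F.1 (x - t * y) - F.1 x) * g y := by
      rw [map_sub, map_smul]
      change (AC.primitive (f.conv (dilate g t))).1 x - (∫ x, g x) * F.1 x = _
      rw [f.primitive_conv_dilate hg ht0, mul_comm, ← integral_const_mul, ← integral_sub
        (BC.integrable_mul F (v := fun y => x - t * y)
          (continuous_const.sub (continuous_const.mul continuous_id)) hg) (hg.const_mul _)]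
      simp only [sub_mul, F]
    rw [e]
    have := (ht x).le
    rwa [dist_zero_left] at this
  refine (AC.norm_le_of_forall _ fun x y => (abs_sub _ _).trans
    (add_le_add (hD y) (hD x))).trans_lt ?_
  linarith

/-! ### Supports -/

lemma test_sum_apply {ι : Type*} (s : Finset ι) (φ : ι → Test) (x : ℝ) :
    (∑ i ∈ s, φ i) x = ∑ i ∈ s, φ i x := by
  classical
  induction s using Finset.induction_on with
  | empty => rfl
  | insert i s hi ih =>
    rw [Finset.sum_insert hi, Finset.sum_insert hi, ← ih]
    rfl

open scoped Manifold in
/-- A distribution vanishes on the complement of its support: a smooth partition of unity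
splits a test function supported there into finitely many pieces, each supported in an open set on
which the distribution vanishes. -/
lemma apply_eq_zero_of_disjoint_dsupport (T : Dist) (φ : Test)
    (h : Disjoint (tsupport φ) (Distribution.dsupport T)) : T φ = 0 := by
  have hx : ∀ x : tsupport φ, ∃ s : Set ℝ,
      Distribution.IsVanishingOn T s ∧ IsOpen s ∧ (x : ℝ) ∈ s := fun x =>
    (Distribution.notMem_dsupport_iff _).1 (disjoint_left.1 h x.2)
  choose U hU hUo hxU using hx
  obtain ⟨t, ht⟩ := φ.hasCompactSupport.isCompact.elim_finite_subcover U hUo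
    fun x hx => mem_iUnion.2 ⟨⟨x, hx⟩, hxU _⟩
  obtain ⟨ρ, hρ⟩ := SmoothPartitionOfUnity.exists_isSubordinate 𝓘(ℝ, ℝ)
    (isClosed_tsupport φ) (fun i : t => U i) (fun i => hUo i)
    (fun x hx => by simpa using ht hx)
  let φs : t → Test := fun i => ⟨fun x => ρ i x * φ x,
    (ρ i).contMDiff.contDiff.mul φ.contDiff, φ.hasCompactSupport.mul_left, by simp⟩
  have e : φ = ∑ i, φs i := by
    ext x
    rw [test_sum_apply]
    change φ x = ∑ i, ρ i x * φ x
    rw [← Finset.sum_mul]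
    by_cases hx : x ∈ tsupport φ
    · have := ρ.sum_eq_one hx
      rw [finsum_eq_sum_of_fintype] at this
      rw [this, one_mul]
    · rw [image_eq_zero_of_notMem_tsupport hx, mul_zero]
  rw [e, map_sum]
  exact Finset.sum_eq_zero fun i _ => hU i _ ((tsupport_mul_subset_left).trans (hρ i))

lemma ofFun_apply_of_integrable {u : ℝ → ℝ} (hu : Integrable u) (φ : Test) :
    ofFun u φ = ∫ x, φ x * u x :=
  TestFunction.integralAgainstBilinCLM_eq_integral (B := ContinuousLinearMap.mul ℝ ℝ)
    (hu.locallyIntegrable.locallyIntegrableOn _) (f := φ)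

lemma ae_eq_zero_of_notMem_dsupport {g : ℝ → ℝ} (hg : Integrable g) :
    ∀ᵐ x, x ∉ Distribution.dsupport (ofFun g) → g x = 0 := by
  refine Distribution.isClosed_dsupport.isOpen_compl.ae_eq_zero_of_integral_contDiff_smul_eq_zero
    (hg.locallyIntegrable.locallyIntegrableOn _) fun φ hφ hc hs => ?_
  let Φ : Test := ⟨φ, hφ, hc, by simp⟩
  have := apply_eq_zero_of_disjoint_dsupport (ofFun g) Φ (subset_compl_iff_disjoint_right.1 hs)
  rw [ofFun_apply_of_integrable hg] at this
  exact this

/-- The pairing of `f ∗ g` with a test function `φ` is the average, with weight `g`, of the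
pairings of `f` with the translates of `φ`. -/
lemma AC.toDist_conv_apply (f : AC) {g : ℝ → ℝ} (hg : Integrable g) (φ : Test) :
    AC.toDist (f.conv g) φ = ∫ y, g y * AC.toDist f (testTranslate (-y) φ) := by
  obtain ⟨ψ, hψ⟩ := exists_deriv φ
  set F := AC.primitive f
  obtain ⟨C, hC⟩ := BC.exists_abs_le F
  have h1 : ∀ y, AC.toDist f (testTranslate (-y) φ) = -∫ x, ψ x * F.1 (x - y) := by
    intro y
    rw [AC.toDist_apply f _ (testTranslate (-y) ψ) fun x => ?_,
      ← integral_sub_right_eq_self (fun x => testTranslate (-y) ψ x * (AC.primitive f).1 x) y]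
    · simp [testTranslate_apply, F]
    · rw [testTranslate_apply, hψ]
      exact (deriv_comp_sub_const (f := φ) (-y) x).symm
  have hψi : Integrable ψ := ψ.continuous.integrable_of_hasCompactSupport ψ.hasCompactSupport
  have h2 : Integrable (Function.uncurry fun x y => ψ x * (F.1 (x - y) * g y)) := by
    have := (hψi.mul_prod hg).bdd_mul (c := C) (f := fun p : ℝ × ℝ => F.1 (p.1 - p.2))
      (F.2.1.comp (continuous_fst.sub continuous_snd)).aestronglyMeasurable
      (ae_of_all _ fun p => hC _)
    refine this.congr (ae_of_all _ fun p => ?_)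
    simp only [Function.uncurry]
    ring
  rw [AC.toDist_apply _ φ ψ hψ]
  simp_rw [AC.primitive_conv f hg, h1, ← integral_const_mul]
  rw [integral_integral_swap h2, ← integral_neg]
  congr 1
  ext y
  rw [mul_neg, ← integral_const_mul]
  congr 2
  ext x
  ring

open scoped Pointwise in
/-- If `φ` is supported off the closure of the sum set, its translate by a point `y` of the support
of `g` is supported off the support of `f`; for the other `y`, `g y` vanishes almost everywhere. -/
lemma AC.dsupport_conv_subset (f : AC) {g : ℝ → ℝ} (hg : Integrable g) :
    Distribution.dsupport (AC.toDist (f.conv g)) ⊆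
      closure (Distribution.dsupport (AC.toDist f) + Distribution.dsupport (ofFun g)) := by
  refine sInter_subset_of_mem ⟨fun φ hφ => ?_, isClosed_closure⟩
  rw [f.toDist_conv_apply hg]
  refine integral_eq_zero_of_ae ?_
  filter_upwards [ae_eq_zero_of_notMem_dsupport hg] with y hy
  by_cases hyg : y ∈ Distribution.dsupport (ofFun g)
  · have h0 : AC.toDist f (testTranslate (-y) φ) = 0 := by
      refine apply_eq_zero_of_disjoint_dsupport _ _ (disjoint_left.2 fun x hx hxf => ?_)
      have hx' : x + y ∈ tsupport φ := by
        have e : (testTranslate (-y) φ : ℝ → ℝ) = φ ∘ Homeomorph.addRight y := by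
          ext x
          simp [testTranslate_apply]
        rw [e, tsupport_comp_eq_preimage] at hx
        exact hx
      exact hφ hx' (subset_closure (add_mem_add hxf hyg))
    rw [h0, mul_zero]
    rfl
  · rw [hy hyg, zero_mul]
    rfl

end CPI

end

open CPI in
open scoped Pointwise Convolution in
theorem mainTheorem2 :
    -- the convolution is well defined
    (∀ (f : AC) (g : ℝ → ℝ), Integrable g →
      f.IsConv g (f.conv g) ∧ ∀ k : AC, f.IsConv g k → k = f.conv g) ∧
    -- (a)
    (∀ (f : AC) (g : ℝ → ℝ), Integrable g → ‖f.conv g‖ ≤ ‖f‖ * ∫ x, |g x|) ∧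
    -- (b)
    (∀ (f : AC) (g h : ℝ → ℝ), Integrable g → Integrable h →
      Integrable (g ⋆[ContinuousLinearMap.mul ℝ ℝ, volume] h) ∧
      (f.conv g).conv h = f.conv (g ⋆[ContinuousLinearMap.mul ℝ ℝ, volume] h)) ∧
    -- (c)
    (∀ (f : AC) (g : ℝ → ℝ) (z : ℝ), Integrable g →
      (f.conv g).translate z = (f.translate z).conv g ∧
      (f.conv g).translate z = f.conv (fun x => g (x - z))) ∧
    -- (d)
    (∀ f : AC, ∃ Φ : (ℝ →₁[volume] ℝ) →L[ℝ] AC,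
      (∀ g : ℝ →₁[volume] ℝ, Φ g = f.conv g) ∧ ‖Φ‖ ≤ ‖f‖) ∧
    (∃ f : AC, f ≠ 0 ∧ ∃ Φ : (ℝ →₁[volume] ℝ) →L[ℝ] AC,
      (∀ g : ℝ →₁[volume] ℝ, Φ g = f.conv g) ∧ ‖Φ‖ = ‖f‖) ∧
    (∀ g : ℝ →₁[volume] ℝ, ∃ Ψ : AC →L[ℝ] AC,
      (∀ f : AC, Ψ f = f.conv g) ∧ ‖Ψ‖ ≤ ‖g‖) ∧
    (∃ g : ℝ →₁[volume] ℝ, g ≠ 0 ∧ ∃ Ψ : AC →L[ℝ] AC,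
      (∀ f : AC, Ψ f = f.conv g) ∧ ‖Ψ‖ = ‖g‖) ∧
    -- (e)
    (∀ (f : AC) (g : ℝ → ℝ), Integrable g →
      (∀ t : ℝ, 0 < t → ∫ x, dilate g t x = ∫ x, g x) ∧
      Tendsto (fun t : ℝ => ‖f.conv (dilate g t) - (∫ x, g x) • f‖) (𝓝[>] 0) (𝓝 0)) ∧
    -- (f)
    (∀ (f : AC) (g : ℝ → ℝ), Integrable g →
      Distribution.dsupport (AC.toDist (f.conv g)) ⊆
        closure (Distribution.dsupport (AC.toDist f) + Distribution.dsupport (ofFun g)) ∧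
      (IsClosed (Distribution.dsupport (AC.toDist f) + Distribution.dsupport (ofFun g)) →
        Distribution.dsupport (AC.toDist (f.conv g)) ⊆
          Distribution.dsupport (AC.toDist f) + Distribution.dsupport (ofFun g))) := by
  refine ⟨fun f g hg => ⟨f.isConv_conv hg, fun k hk => hk.unique hg (f.isConv_conv hg)⟩,
    fun f g hg => f.norm_conv_le hg,
    fun f g h hg hh => ⟨hg.integrable_convolution _ hh, f.conv_conv hg hh⟩,
    fun f g z hg => ⟨f.translate_conv hg z, f.translate_conv_right hg z⟩,
    fun f => ⟨f.convRight, f.convRight_apply, f.norm_convRight_le⟩, ?_,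
    fun g => ⟨AC.convLeft g, AC.convLeft_apply g, AC.norm_convLeft_le g⟩, ?_,
    fun f g hg => ⟨fun t ht => integral_dilate g ht, f.tendsto_conv_dilate hg⟩,
    fun f g hg => ⟨f.dsupport_conv_subset hg, fun hc => ?_⟩⟩
  · obtain ⟨f, g, hf, hg, hfg⟩ := exists_norm_conv_eq
    refine ⟨f, norm_ne_zero_iff.1 (by simp [hf]), f.convRight, f.convRight_apply,
      le_antisymm f.norm_convRight_le ?_⟩
    have := f.convRight.le_opNorm g
    rw [hg, mul_one] at this
    exact hf.le.trans (hfg.trans this)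
  · obtain ⟨f, g, hf, hg, hfg⟩ := exists_norm_conv_eq
    refine ⟨g, norm_ne_zero_iff.1 (by simp [hg]), AC.convLeft g, AC.convLeft_apply g,
      le_antisymm (AC.norm_convLeft_le g) ?_⟩
    have := (AC.convLeft g).le_opNorm f
    rw [hf, mul_one] at this
    exact hg.le.trans (hfg.trans this)
  · have := f.dsupport_conv_subset hg
    rwa [hc.closure_eq] at this
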